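/- **Setting.** Terms are first-order terms over variables, integers, `null`, `ok`, lists, references $r(N)$, exception flags $exc(N)$, class, field and type names, objects $object(C,Fields)$ with $Fields$ a list of terms $field(FN,Data)$, and arrays $array(T,L,Xs)$. A heap is a list of cells $(Ref,Cell)$, where $Cell$ is an object or an array; during symbolic execution any part, in particular the tail of a heap or of a list of fields, may be a variable. *Programs.* A CLP-decompiled program $P$ consists of a single-inheritance class table and of clauses $$p(Args_{in},Args_{out},H_{in},H_{out},ExFlag)\ \texttt{:-}\ G_1,\dots,G_j,B_1,\dots,B_n .$$ Guards $G_i$ are integer comparisons, disequalities $Ref_1\neq Ref_2$, and $type(H,Ref,T)$, which says that the cell of $Ref$ is an object of class $T$. Instructions $B_i$ are $X = t\ op\ u$ with $op$ one of $+,-,*,/,\bmod$; calls $q(Args,Args',H,H',E)$; $new\_object$, $new\_array$, $length$, $get\_field$, $set\_field$, $get\_array$, $set\_array$. The heap is passed from $H_{in}$ through the instructions in order to $H_{out}$. Every variable is given a value before it is used: by the input arguments, by an earlier $type$ guard or by the result of an earlier instruction; $Args_{out}$ and $ExFlag$ only contain variables that have a value at the end of the clause. *Execution.* A state $\langle G \mid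 \theta\rangle$ is a list of goals with a store $\theta=(\sigma,\gamma)$, $\sigma$ a substitution and $\gamma$ a finite set of constraints, to which $\sigma$ has been applied. The leftmost goal is reduced: a call by resolution with a clause renamed apart, equations by most general unifiers, arithmetic by computing when both operands are numbers and by adding a constraint otherwise; comparisons and disequalities are added to $\gamma$. Only states with satisfiable $\gamma$ are reached. The heap operations are the following ($\_$ stands for fresh variables). - $new\_object(H,C,Ref,H')$ and $new\_array(H,T,L,Ref,H')$ build an object of class $C$, or an array of $L$ elements of type $T$, filled with default values ($0$ or $null$), let $Ref$ be a number that is the reference of no cell of $H$ (this freshness is recorded as a constraint in $\gamma$, as $H$ may be partly unknown), and set $H'=[(Ref,Cell)|H]$. - $type$, $length$, $get\_field$, $get\_array$ read the cell of $Ref$ with $get\_cell(H,Ref,Cell)$; $set\_field$, $set\_array$ read it in the same way and then replace it with $set\_cell(H,Ref,Cell',H')$. Access to a field $C{:}FN$ requires the class $T$ of the object to be a declared class with $subclass(T,C)$, and takes the first entry of the list of fields with name $FN$; if the list ends in a variable before that, the entry is added there. Access to position $I$ of an array takes the element of index $I=0,1,\dots$ of its list of elements. - Ground execution uses the clauses $get\_cell([(Ref',Cell')|\_],Ref,Cell)\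 \texttt{:-}\ Ref\ \texttt{==}\ Ref',\ !,\ Cell=Cell'$ and $get\_cell([\_|RH],Ref,Cell)\ \texttt{:-}\ get\_cell(RH,Ref,Cell)$. Symbolic execution adds, before the first of them, $get\_cell(H,Ref,Cell)\ \texttt{:-}\ var(H),\ !,\ H=[(Ref,Cell)|\_]$ and, between the two, the aliasing clause $get\_cell([(Ref',Cell')|\_],Ref,Cell)\ \texttt{:-}\ var(Ref),\ var(Ref'),\ Ref=Ref',\ Cell=Cell'$. - $set\_cell$ replaces the first cell whose reference is syntactically equal to $Ref$. *Instantiations.* Below, substitutions are compared on the five variables $Args_{in},Args_{out},H_{in},H_{out},ExFlag$ of the initial goal: $\sigma'\le\sigma$ means that for some substitution $\rho$, $x\sigma'=x\sigma\rho$ for these five variables $x$. A substitution $\sigma'$ is an *instantiation* of $\theta=(\sigma,\gamma)$ if $\sigma'\le\sigma$, with some $\rho$ such that $\gamma\rho$ is satisfiable. For stores, $(\sigma_1,\gamma_1)\le(\sigma_2,\gamma_2)$ means that $\sigma_1\le\sigma_2$ and that for every ground solution $v$ of $\gamma_1$ there is a ground solution $w$ of $\gamma_2$ with $x\sigma_1v=x\sigma_2w$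 for each of the five variables $x$. **Theorem (correctness).** Let $P$ be a CLP-decompiled program, $m$ one of its predicates, and let $$S_0=\langle m(Args_{in},Args_{out},H_{in},H_{out},ExFlag)\mid\{\}\rangle\to S_1\to\dots\to\langle\varepsilon\mid\theta\rangle$$ be a successful branch of the symbolic execution of $m$, where the five arguments are distinct variables. Let $\sigma'$ be an instantiation of $\theta$ such that $Args_{in}\sigma'$ and $H_{in}\sigma'$ are ground and no reference occurs twice among the cells of the heap $H_{in}\sigma'$. Then the ground execution of $\langle m(Args_{in},Args_{out},H_{in},H_{out},ExFlag)\sigma'\mid\{\}\rangle$ has a successful derivation that results in a state $\langle\varepsilon\mid\theta'\rangle$ with $\theta'\le\theta$, where the substitution of $\theta'$ is understood as composed with $\sigma'$, so that it acts on the five variables. -/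

import Mathlib

namespace CLP

/-! ### Terms, substitutions, unification -/

abbrev ClassName := ℕ
abbrev FieldName := ℕ
abbrev PredName := ℕ

/-- Types of the imperative language: `bool`, `int`, a class, `array(T)`. -/
inductive Ty
  | bool
  | int
  | cls (C : ClassName)
  | arr (T : Ty)

/-- Constants occurring in terms. -/
inductive Const
  | nil
  | null
  | ok
  | tbool
  | tint
  | cls (C : ClassName)
  | fname (F : FieldName)

/-- Unary functors: references `r(N)`, exception flags `exc(N)`, array types `array(T)`. -/
inductive Fun1
  | ref
  | exc
  | arr

/-- Binary functors: list cells `[X|Xs]`, heap locations `(Ref,Cell)`,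
objects `object(C,Fields)`, fields `field(FN,Data)`. -/
inductive Fun2
  | cons
  | loc
  | object
  | field

/-- First-order terms over this signature. `array3 T L Xs` is the array cell `array(T,L,Xs)`. -/
inductive Term
  | var (x : ℕ)
  | num (z : ℤ)
  | const (c : Const)
  | fun1 (f : Fun1) (t : Term)
  | fun2 (f : Fun2) (t u : Term)
  | array3 (t l xs : Term)

namespace Term

abbrev nil : Term := const Const.nil
abbrev null : Term := const Const.null
abbrev ok : Term := const Const.ok
abbrev cls (C : ClassName) : Term := const (Const.cls C)
abbrev ref (t : Term) : Term := fun1 Fun1.ref t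
abbrev exc (t : Term) : Term := fun1 Fun1.exc t
abbrev cons (t u : Term) : Term := fun2 Fun2.cons t u
abbrev loc (r c : Term) : Term := fun2 Fun2.loc r c
abbrev object (c fs : Term) : Term := fun2 Fun2.object c fs
abbrev field (F : FieldName) (d : Term) : Term := fun2 Fun2.field (const (Const.fname F)) d

/-- The Prolog list `[t₁,…,tₖ]`. -/
def list : List Term → Term
  | [] => nil
  | t :: ts => cons t (list ts)

/-- The Prolog list `[t₁,…,tₖ|rest]`. -/
def listTail (rest : Term) : List Term → Term
  | [] => rest
  | t :: ts => cons t (listTail rest ts)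

def vars : Term → Finset ℕ
  | var x => {x}
  | num _ => ∅
  | const _ => ∅
  | fun1 _ t => t.vars
  | fun2 _ t u => t.vars ∪ u.vars
  | array3 t l xs => t.vars ∪ l.vars ∪ xs.vars

def Ground (t : Term) : Prop := t.vars = ∅

def subst (σ : ℕ → Term) : Term → Term
  | var x => σ x
  | num z => num z
  | const c => const c
  | fun1 f t => fun1 f (t.subst σ)
  | fun2 f t u => fun2 f (t.subst σ) (u.subst σ)
  | array3 t l xs => array3 (t.subst σ) (l.subst σ) (xs.subst σ)

/-- The references of the cells listed in a heap `[(Ref₁,Cell₁),(Ref₂,Cell₂),…]`. -/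
def locs : Term → List Term
  | fun2 Fun2.cons (fun2 Fun2.loc r _) h => r :: h.locs
  | fun2 Fun2.cons _ h => h.locs
  | _ => []

end Term

/-- One more than the largest variable of a finite set of variables. -/
def varBound (s : Finset ℕ) : ℕ := s.sup (· + 1)

def listVars (ts : List Term) : Finset ℕ := (Term.list ts).vars

/-- The `n`-th, `n+1`-st, …, `n+k-1`-st variables. -/
def freshVars (n k : ℕ) : List Term := (List.range k).map fun i => Term.var (n + i)

/-- Substitutions. -/
abbrev Subst := ℕ → Term

namespace Subst

def id : Subst := Term.var

/-- First `σ`, then `μ`. -/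
def comp (σ μ : Subst) : Subst := fun x => (σ x).subst μ

/-- Ground valuations. -/
def IsGround (σ : Subst) : Prop := ∀ x, (σ x).Ground

/-- `μ` is an (idempotent) most general unifier of `t` and `u`. -/
def IsMGU (μ : Subst) (t u : Term) : Prop :=
  t.subst μ = u.subst μ ∧
    ∀ ν : Subst, t.subst ν = u.subst ν → ∀ x, (μ x).subst ν = ν x

end Subst

namespace Ty

def toTerm : Ty → Term
  | bool => Term.const Const.tbool
  | int => Term.const Const.tint
  | cls C => Term.cls C
  | arr T => Term.fun1 Fun1.arr T.toTerm

/-- The default value with which fields and array positions are initialised. -/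
def default : Ty → Term
  | bool => Term.num 0
  | int => Term.num 0
  | cls _ => Term.null
  | arr _ => Term.null

end Ty

/-! ### Constraints -/

/-- Arithmetic relations `#>`, `#<`, `#>=`, `#=<`, `#=`, `#\=`. -/
inductive ROp
  | gt
  | lt
  | ge
  | le
  | eq
  | ne

def ROp.Holds : ROp → ℤ → ℤ → Prop
  | gt, a, b => a > b
  | lt, a, b => a < b
  | ge, a, b => a ≥ b
  | le, a, b => a ≤ b
  | eq, a, b => a = b
  | ne, a, b => a ≠ b

inductive AOp
  | add
  | sub
  | mul
  | div
  | mod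

/-- Integer arithmetic; division (truncating) and `mod` by zero are undefined. -/
def AOp.eval : AOp → ℤ → ℤ → Option ℤ
  | add, a, b => some (a + b)
  | sub, a, b => some (a - b)
  | mul, a, b => some (a * b)
  | div, a, b => if b = 0 then none else some (a.tdiv b)
  | mod, a, b => if b = 0 then none else some (a.fmod b)

/-- Primitive constraints of the store. -/
inductive Constraint
  /-- `t op u` -/
  | rel (op : ROp) (t u : Term)
  /-- `x #= t op u` -/
  | arith (op : AOp) (x t u : Term)
  /-- `t` and `u` are different (references) -/
  | neq (t u : Term)
  /-- no cell of the heap `h` has reference `r` -/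
  | fresh (r h : Term)

namespace Constraint

def subst (σ : Subst) : Constraint → Constraint
  | rel op t u => rel op (t.subst σ) (u.subst σ)
  | arith op x t u => arith op (x.subst σ) (t.subst σ) (u.subst σ)
  | neq t u => neq (t.subst σ) (u.subst σ)
  | fresh r h => fresh (r.subst σ) (h.subst σ)

/-- Truth of a constraint under a (ground) valuation. -/
def Holds (v : Subst) : Constraint → Prop
  | rel op t u => ∃ a b, t.subst v = Term.num a ∧ u.subst v = Term.num b ∧ op.Holds a b
  | arith op x t u => ∃ a b c, t.subst v = Term.num a ∧ u.subst v = Term.num b ∧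
      x.subst v = Term.num c ∧ op.eval a b = some c
  | neq t u => t.subst v ≠ u.subst v
  | fresh r h => r.subst v ∉ (h.subst v).locs

end Constraint

/-- `v` is a solution of the set of constraints `γ`. -/
def IsSolution (v : Subst) (γ : List Constraint) : Prop :=
  v.IsGround ∧ ∀ c ∈ γ, c.Holds v

def Satisfiable (γ : List Constraint) : Prop := ∃ v, IsSolution v γ

/-! ### CLP-decompiled programs -/

/-- Guards `t op u`, `Ref₁ \== Ref₂`, `type(H,Ref,T)`. -/
inductive Guard
  | rel (op : ROp) (t u : Term)
  | neq (t u : Term)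
  | type (r t : Term)

/-- Instructions. The heap arguments are not written: as decompilation produces them, every
instruction works on the heap left by the previous one, see `Instr.goal` and `bodyGoals`. -/
inductive Instr
  /-- `X #= t op u` -/
  | arith (op : AOp) (x : ℕ) (t u : Term)
  /-- `p(Args_in,Args_out,H,H',ExFlag)` -/
  | call (p : PredName) (argsIn argsOut : List Term) (exFlag : Term)
  /-- `new_object(H,C,Ref,H')` -/
  | newObject (c : Term) (r : ℕ)
  /-- `new_array(H,T,L,Ref,H')` -/
  | newArray (T : Ty) (l : Term) (r : ℕ)
  /-- `length(H,Ref,L)` -/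
  | length (r : Term) (x : ℕ)
  /-- `get_field(H,Ref,C:FN,V)` -/
  | getField (r : Term) (C : ClassName) (F : FieldName) (x : ℕ)
  /-- `set_field(H,Ref,C:FN,Data,H')` -/
  | setField (r : Term) (C : ClassName) (F : FieldName) (d : Term)
  /-- `get_array(H,Ref,I,V)` -/
  | getArray (r i : Term) (x : ℕ)
  /-- `set_array(H,Ref,I,Data,H')` -/
  | setArray (r i d : Term)

/-- The variables whose value a guard needs. -/
def Guard.inputs : Guard → Finset ℕ
  | rel _ t u => t.vars ∪ u.vars
  | neq t u => t.vars ∪ u.vars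
  | type r _ => r.vars

/-- The variables to which a guard gives a value. -/
def Guard.outputs : Guard → Finset ℕ
  | type _ t => t.vars
  | _ => ∅

/-- The variables whose value an instruction needs. -/
def Instr.inputs : Instr → Finset ℕ
  | arith _ _ t u => t.vars ∪ u.vars
  | call _ argsIn _ _ => listVars argsIn
  | newObject c _ => c.vars
  | newArray _ l _ => l.vars
  | length r _ => r.vars
  | getField r _ _ _ => r.vars
  | setField r _ _ d => r.vars ∪ d.vars
  | getArray r i _ => r.vars ∪ i.vars
  | setArray r i d => r.vars ∪ i.vars ∪ d.vars

/-- The variables to which an instruction gives a value. -/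
def Instr.outputs : Instr → Finset ℕ
  | arith _ x _ _ => {x}
  | call _ _ argsOut exFlag => listVars argsOut ∪ exFlag.vars
  | newObject _ r => {r}
  | newArray _ _ r => {r}
  | length _ x => {x}
  | getField _ _ _ x => {x}
  | setField _ _ _ _ => ∅
  | getArray _ _ x => {x}
  | setArray _ _ _ => ∅

/-- Clauses `p(Args_in,Args_out,H_in,H_out,ExFlag) :- G₁,…,Gⱼ,B₁,…,Bₙ`. -/
structure Clause where
  pred : PredName
  argsIn : List Term
  argsOut : List Term
  exFlag : Term
  guards : List Guard
  body : List Instr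

namespace Clause

/-- The variables that have a value once the head has been entered and the guards evaluated. -/
def GuardsOk : Finset ℕ → List Guard → Prop
  | _, [] => True
  | D, g :: gs => g.inputs ⊆ D ∧ GuardsOk (D ∪ g.outputs) gs

/-- Every instruction of the body only needs variables that have a value at that point, and
the variables of `out` have a value at the end. -/
def BodyOk (out : Finset ℕ) : Finset ℕ → List Instr → Prop
  | D, [] => out ⊆ D
  | D, i :: is => i.inputs ⊆ D ∧ BodyOk out (D ∪ i.outputs) is

/-- All variables have been given a value before they are used; the input arguments have one
from the start, the outputs of the clause must have one at its end. -/
def DefinedBeforeUse (c : Clause) : Prop :=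
  GuardsOk (listVars c.argsIn) c.guards ∧
    BodyOk (listVars c.argsOut ∪ c.exFlag.vars)
      (c.guards.foldl (fun D g => D ∪ g.outputs) (listVars c.argsIn)) c.body

def vars (c : Clause) : Finset ℕ :=
  listVars c.argsIn ∪ listVars c.argsOut ∪ c.exFlag.vars ∪
    c.guards.foldr (fun g D => g.inputs ∪ g.outputs ∪ D) ∅ ∪
    c.body.foldr (fun i D => i.inputs ∪ i.outputs ∪ D) ∅

end Clause

/-- A class with its superclass, if any, and the fields that it declares itself. -/
structure ClassDecl where
  name : ClassName
  super : Option ClassName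
  fields : List (FieldName × Ty)

/-- A CLP-decompiled program: the clauses and the class hierarchy. -/
structure Program where
  classes : List ClassDecl
  clauses : List Clause
  defined : ∀ c ∈ clauses, c.DefinedBeforeUse

namespace Program

variable (P : Program)

/-- `D` is declared as a direct subclass of `C`. -/
def Extends (D C : ClassName) : Prop :=
  ∃ d ∈ P.classes, d.name = D ∧ d.super = some C

/-- `subclass(D,C)`: `D` is a declared class that equals `C` or is a descendant of `C`. -/
def Subclass (D C : ClassName) : Prop :=
  (∃ d ∈ P.classes, d.name = D) ∧ Relation.ReflTransGen P.Extends D C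

/-- The fields of the objects of a class: its own and the inherited ones. -/
inductive FieldsOf : ClassName → List (FieldName × Ty) → Prop
  | root (d : ClassDecl) : d ∈ P.classes → d.super = none → FieldsOf d.name d.fields
  | sub (d : ClassDecl) (C : ClassName) (fs : List (FieldName × Ty)) :
      d ∈ P.classes → d.super = some C → FieldsOf C fs → FieldsOf d.name (d.fields ++ fs)

end Program

/-- The term `[field(FN₁,default₁),…]`. -/
def initFields (fs : List (FieldName × Ty)) : Term :=
  Term.list (fs.map fun f => Term.field f.1 f.2.default)

/-! ### Goals -/

/-- Atomic goals: unification, calls, and the heap operations with their auxiliary predicates. -/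
inductive Goal
  | eq (t u : Term)
  | call (p : PredName) (argsIn argsOut hIn hOut exFlag : Term)
  | rel (op : ROp) (t u : Term)
  | arith (op : AOp) (x t u : Term)
  | neq (t u : Term)
  | type (h r t : Term)
  | newObject (h c r h' : Term)
  | newArray (h : Term) (T : Ty) (l r h' : Term)
  | length (h r l : Term)
  | getField (h r : Term) (C : ClassName) (F : FieldName) (v : Term)
  | setField (h r : Term) (C : ClassName) (F : FieldName) (v h' : Term)
  | getArray (h r i v : Term)
  | setArray (h r i v h' : Term)
  | getCell (h r c : Term)
  | setCell (h r c h' : Term)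
  | newRef (h r : Term)
  | buildObject (c ob : Term)
  | buildArray (T : Ty) (l ar : Term)
  | subclass (t : Term) (C : ClassName)
  | memberDet (F : FieldName) (v fs : Term)
  | replaceDet (fs : Term) (F : FieldName) (v fs' : Term)
  | nth0 (i xs v : Term)
  | replaceNth0 (xs i v xs' : Term)

def Goal.subst (σ : Subst) : Goal → Goal
  | eq t u => eq (t.subst σ) (u.subst σ)
  | call p a o h h' e =>
      call p (a.subst σ) (o.subst σ) (h.subst σ) (h'.subst σ) (e.subst σ)
  | rel op t u => rel op (t.subst σ) (u.subst σ)
  | arith op x t u => arith op (x.subst σ) (t.subst σ) (u.subst σ)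
  | neq t u => neq (t.subst σ) (u.subst σ)
  | type h r t => type (h.subst σ) (r.subst σ) (t.subst σ)
  | newObject h c r h' => newObject (h.subst σ) (c.subst σ) (r.subst σ) (h'.subst σ)
  | newArray h T l r h' => newArray (h.subst σ) T (l.subst σ) (r.subst σ) (h'.subst σ)
  | length h r l => length (h.subst σ) (r.subst σ) (l.subst σ)
  | getField h r C F v => getField (h.subst σ) (r.subst σ) C F (v.subst σ)
  | setField h r C F v h' => setField (h.subst σ) (r.subst σ) C F (v.subst σ) (h'.subst σ)
  | getArray h r i v => getArray (h.subst σ) (r.subst σ) (i.subst σ) (v.subst σ)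
  | setArray h r i v h' =>
      setArray (h.subst σ) (r.subst σ) (i.subst σ) (v.subst σ) (h'.subst σ)
  | getCell h r c => getCell (h.subst σ) (r.subst σ) (c.subst σ)
  | setCell h r c h' => setCell (h.subst σ) (r.subst σ) (c.subst σ) (h'.subst σ)
  | newRef h r => newRef (h.subst σ) (r.subst σ)
  | buildObject c ob => buildObject (c.subst σ) (ob.subst σ)
  | buildArray T l ar => buildArray T (l.subst σ) (ar.subst σ)
  | subclass t C => subclass (t.subst σ) C
  | memberDet F v fs => memberDet F (v.subst σ) (fs.subst σ)
  | replaceDet fs F v fs' => replaceDet (fs.subst σ) F (v.subst σ) (fs'.subst σ)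
  | nth0 i xs v => nth0 (i.subst σ) (xs.subst σ) (v.subst σ)
  | replaceNth0 xs i v xs' =>
      replaceNth0 (xs.subst σ) (i.subst σ) (v.subst σ) (xs'.subst σ)

/-- The goal of a guard that is evaluated on the heap variable `h`. -/
def Guard.goal (h : ℕ) : Guard → Goal
  | rel op t u => Goal.rel op t u
  | neq t u => Goal.neq t u
  | type r t => Goal.type (Term.var h) r t

/-- The heap variable after an instruction that starts with heap variable `h`: the next
variable if the instruction has an output heap, and `h` otherwise. -/
def Instr.outHeap (h : ℕ) : Instr → ℕ
  | call _ _ _ _ => h + 1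
  | newObject _ _ => h + 1
  | newArray _ _ _ => h + 1
  | setField _ _ _ _ => h + 1
  | setArray _ _ _ => h + 1
  | _ => h

/-- The goal of an instruction with input heap variable `h` and output heap variable `h'`. -/
def Instr.goal (h h' : ℕ) : Instr → Goal
  | arith op x t u => Goal.arith op (Term.var x) t u
  | call p argsIn argsOut e =>
      Goal.call p (Term.list argsIn) (Term.list argsOut) (Term.var h) (Term.var h') e
  | newObject c r => Goal.newObject (Term.var h) c (Term.var r) (Term.var h')
  | newArray T l r => Goal.newArray (Term.var h) T l (Term.var r) (Term.var h')
  | length r x => Goal.length (Term.var h) r (Term.var x)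
  | getField r C F x => Goal.getField (Term.var h) r C F (Term.var x)
  | setField r C F d => Goal.setField (Term.var h) r C F d (Term.var h')
  | getArray r i x => Goal.getArray (Term.var h) r i (Term.var x)
  | setArray r i d => Goal.setArray (Term.var h) r i d (Term.var h')

/-- The goals of a body, with the heap passed on from instruction to instruction. -/
def bodyGoals : ℕ → List Instr → List Goal
  | _, [] => []
  | h, i :: is => i.goal h (i.outHeap h) :: bodyGoals (i.outHeap h) is

/-- The heap variable at the end of a body. -/
def lastHeap : ℕ → List Instr → ℕ
  | h, [] => h
  | h, i :: is => lastHeap (i.outHeap h) is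

namespace Clause

/-- The variable `H_in` of the clause: the first one that does not occur in it otherwise. -/
def heapIn (c : Clause) : ℕ := varBound c.vars

def heapOut (c : Clause) : ℕ := lastHeap c.heapIn c.body

/-- The head arguments, to be unified with those of a call. -/
def headEqs (c : Clause) (ren : Subst) (a o h h' e : Term) : List Goal :=
  [Goal.eq a ((Term.list c.argsIn).subst ren), Goal.eq o ((Term.list c.argsOut).subst ren),
    Goal.eq h ((Term.var c.heapIn).subst ren), Goal.eq h' ((Term.var c.heapOut).subst ren),
    Goal.eq e (c.exFlag.subst ren)]

/-- The right-hand side of the clause with all heap arguments made explicit. -/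
def rhs (c : Clause) : List Goal :=
  c.guards.map (Guard.goal c.heapIn) ++ bodyGoals c.heapIn c.body

end Clause

/-! ### Operational semantics -/

/-- `ground`: the plain heap operations; `symbolic`: `get_cell` has the two further clauses
for unknown heaps and for aliasing. -/
inductive Mode
  | ground
  | symbolic

/-- `Reduct P m σ n g gs cs k`: when `σ` is the current substitution and the variables from `n`
on are unused, the goal `g` may be replaced by the goals `gs`, posting the constraints `cs` and
taking the variables `n, …, n+k-1`. -/
inductive Reduct (P : Program) (m : Mode) (σ : Subst) (n : ℕ) :
    Goal → List Goal → List Constraint → ℕ → Prop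
  /-- Resolution with a clause renamed apart. -/
  | call (c : Clause) (a o h h' e : Term) : c ∈ P.clauses →
      Reduct P m σ n (Goal.call c.pred a o h h' e)
        (c.headEqs (fun x => Term.var (n + x)) a o h h' e ++
          c.rhs.map (Goal.subst fun x => Term.var (n + x))) [] (c.heapOut + 1)
  | rel (op : ROp) (t u : Term) :
      Reduct P m σ n (Goal.rel op t u) [] [Constraint.rel op t u] 0
  | neq (t u : Term) :
      Reduct P m σ n (Goal.neq t u) [] [Constraint.neq t u] 0
  /-- Arithmetic on numbers is computed at once. -/
  | arith_eval (op : AOp) (x t u : Term) (a b c : ℤ) :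
      t.subst σ = Term.num a → u.subst σ = Term.num b → op.eval a b = some c →
      Reduct P m σ n (Goal.arith op x t u) [Goal.eq x (Term.num c)] [] 0
  /-- Otherwise it becomes a constraint. -/
  | arith_post (op : AOp) (x t u : Term) :
      (¬ ∃ a b, t.subst σ = Term.num a ∧ u.subst σ = Term.num b) →
      Reduct P m σ n (Goal.arith op x t u) [] [Constraint.arith op x t u] 0
  /-- `type(H,Ref,T) :- get_cell(H,Ref,Cell), Cell = object(T,_)` -/
  | type (h r t : Term) :
      Reduct P m σ n (Goal.type h r t)
        [Goal.getCell h r (Term.var n),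
          Goal.eq (Term.var n) (Term.object t (Term.var (n + 1)))] [] 2
  /-- `new_object(H,C,Ref,H') :- build_object(C,Ob), new_ref(Ref), H' = [(Ref,Ob)|H]` -/
  | newObject (h c r h' : Term) :
      Reduct P m σ n (Goal.newObject h c r h')
        [Goal.buildObject c (Term.var n), Goal.newRef h r,
          Goal.eq h' (Term.cons (Term.loc r (Term.var n)) h)] [] 1
  /-- `new_array(H,T,L,Ref,H') :- build_array(T,L,Arr), new_ref(Ref), H' = [(Ref,Arr)|H]` -/
  | newArray (h : Term) (T : Ty) (l r h' : Term) :
      Reduct P m σ n (Goal.newArray h T l r h')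
        [Goal.buildArray T l (Term.var n), Goal.newRef h r,
          Goal.eq h' (Term.cons (Term.loc r (Term.var n)) h)] [] 1
  /-- `length(H,Ref,L) :- get_cell(H,Ref,Cell), Cell = array(_,L,_)` -/
  | length (h r l : Term) :
      Reduct P m σ n (Goal.length h r l)
        [Goal.getCell h r (Term.var n),
          Goal.eq (Term.var n) (Term.array3 (Term.var (n + 1)) l (Term.var (n + 2)))] [] 3
  /-- `get_field(H,Ref,C:FN,V) :- get_cell(H,Ref,Ob), Ob = object(T,Fields), subclass(T,C),
  member_det(field(FN,V),Fields)` -/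
  | getField (h r : Term) (C : ClassName) (F : FieldName) (v : Term) :
      Reduct P m σ n (Goal.getField h r C F v)
        [Goal.getCell h r (Term.var n),
          Goal.eq (Term.var n) (Term.object (Term.var (n + 1)) (Term.var (n + 2))),
          Goal.subclass (Term.var (n + 1)) C,
          Goal.memberDet F v (Term.var (n + 2))] [] 3
  /-- `set_field(H,Ref,C:FN,V,H') :- get_cell(H,Ref,Ob), Ob = object(T,Fields), subclass(T,C),
  replace_det(Fields,field(FN,_),field(FN,V),Fields'), set_cell(H,Ref,object(T,Fields'),H')` -/
  | setField (h r : Term) (C : ClassName) (F : FieldName) (v h' : Term) :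
      Reduct P m σ n (Goal.setField h r C F v h')
        [Goal.getCell h r (Term.var n),
          Goal.eq (Term.var n) (Term.object (Term.var (n + 1)) (Term.var (n + 2))),
          Goal.subclass (Term.var (n + 1)) C,
          Goal.replaceDet (Term.var (n + 2)) F v (Term.var (n + 3)),
          Goal.setCell h r (Term.object (Term.var (n + 1)) (Term.var (n + 3))) h'] [] 4
  /-- `get_array(H,Ref,I,V) :- get_cell(H,Ref,Arr), Arr = array(_,_,Xs), nth0(I,Xs,V)` -/
  | getArray (h r i v : Term) :
      Reduct P m σ n (Goal.getArray h r i v)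
        [Goal.getCell h r (Term.var n),
          Goal.eq (Term.var n)
            (Term.array3 (Term.var (n + 1)) (Term.var (n + 2)) (Term.var (n + 3))),
          Goal.nth0 i (Term.var (n + 3)) v] [] 4
  /-- `set_array(H,Ref,I,V,H') :- get_cell(H,Ref,Arr), Arr = array(T,L,Xs),
  replace_nth0(Xs,I,V,Xs'), set_cell(H,Ref,array(T,L,Xs'),H')` -/
  | setArray (h r i v h' : Term) :
      Reduct P m σ n (Goal.setArray h r i v h')
        [Goal.getCell h r (Term.var n),
          Goal.eq (Term.var n)
            (Term.array3 (Term.var (n + 1)) (Term.var (n + 2)) (Term.var (n + 3))),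
          Goal.replaceNth0 (Term.var (n + 3)) i v (Term.var (n + 4)),
          Goal.setCell h r
            (Term.array3 (Term.var (n + 1)) (Term.var (n + 2)) (Term.var (n + 4))) h'] [] 5
  /-- `get_cell(H,Ref,Cell) :- var(H), !, H = [(Ref,Cell)|_]` -/
  | getCell_unknown (h r c : Term) (x : ℕ) : m = Mode.symbolic → h.subst σ = Term.var x →
      Reduct P m σ n (Goal.getCell h r c)
        [Goal.eq h (Term.cons (Term.loc r c) (Term.var n))] [] 1
  /-- `get_cell([(Ref',Cell')|_],Ref,Cell) :- Ref == Ref', !, Cell = Cell'` -/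
  | getCell_found (h r c r' c' t : Term) :
      h.subst σ = Term.cons (Term.loc r' c') t → r.subst σ = r' →
      Reduct P m σ n (Goal.getCell h r c) [Goal.eq c c'] [] 0
  /-- `get_cell([(Ref',Cell')|_],Ref,Cell) :- var(Ref), var(Ref'), Ref = Ref', Cell = Cell'` -/
  | getCell_alias (h r c c' t : Term) (x y : ℕ) : m = Mode.symbolic →
      h.subst σ = Term.cons (Term.loc (Term.var y) c') t → r.subst σ = Term.var x → x ≠ y →
      Reduct P m σ n (Goal.getCell h r c) [Goal.eq r (Term.var y), Goal.eq c c'] [] 0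
  /-- `get_cell([_|RH],Ref,Cell) :- get_cell(RH,Ref,Cell)`, in view of the cut only when the
  first cell does not carry `Ref`. -/
  | getCell_next (h r c d t : Term) :
      h.subst σ = Term.cons d t → (∀ c', d ≠ Term.loc (r.subst σ) c') →
      Reduct P m σ n (Goal.getCell h r c) [Goal.getCell t r c] [] 0
  /-- `set_cell([(Ref',_)|H],Ref,Cell,H') :- Ref == Ref', !, H' = [(Ref,Cell)|H]` -/
  | setCell_found (h r c h' r' c' t : Term) :
      h.subst σ = Term.cons (Term.loc r' c') t → r.subst σ = r' →
      Reduct P m σ n (Goal.setCell h r c h') [Goal.eq h' (Term.cons (Term.loc r c) t)] [] 0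
  /-- `set_cell([D|H],Ref,Cell,H') :- H' = [D|H''], set_cell(H,Ref,Cell,H'')`, in view of the
  cut only when the first cell does not carry `Ref`. -/
  | setCell_next (h r c h' d t : Term) :
      h.subst σ = Term.cons d t → (∀ c', d ≠ Term.loc (r.subst σ) c') →
      Reduct P m σ n (Goal.setCell h r c h')
        [Goal.eq h' (Term.cons d (Term.var n)), Goal.setCell t r c (Term.var n)] [] 1
  /-- `new_ref`: a number that is the reference of no cell of the current heap. A part of that
  heap may still be unknown, so that freshness is kept as a constraint. -/
  | newRef (h r : Term) (k : ℤ) :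
      Reduct P m σ n (Goal.newRef h r) [Goal.eq r (Term.num k)]
        [Constraint.fresh (Term.num k) h] 0
  /-- `build_object(C,object(C,[field(FN₁,default₁),…]))`, one fact per class -/
  | buildObject (c ob : Term) (C : ClassName) (fs : List (FieldName × Ty)) :
      P.FieldsOf C fs →
      Reduct P m σ n (Goal.buildObject c ob)
        [Goal.eq c (Term.cls C), Goal.eq ob (Term.object (Term.cls C) (initFields fs))] [] 0
  /-- `build_array(T,L,array(T,L,[default,…,default]))` with `L` default values -/
  | buildArray (T : Ty) (l ar : Term) (k : ℕ) :
      Reduct P m σ n (Goal.buildArray T l ar)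
        [Goal.eq l (Term.num k),
          Goal.eq ar (Term.array3 T.toTerm l (Term.list (List.replicate k T.default)))] [] 0
  | subclass (t : Term) (C D : ClassName) : P.Subclass D C →
      Reduct P m σ n (Goal.subclass t C) [Goal.eq t (Term.cls D)] [] 0
  /-- The list of fields ends in an unknown part: the field is put there. -/
  | memberDet_unknown (F : FieldName) (v fs : Term) (x : ℕ) : fs.subst σ = Term.var x →
      Reduct P m σ n (Goal.memberDet F v fs)
        [Goal.eq fs (Term.cons (Term.field F v) (Term.var n))] [] 1
  | memberDet_found (F : FieldName) (v fs d t : Term) :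
      fs.subst σ = Term.cons (Term.field F d) t →
      Reduct P m σ n (Goal.memberDet F v fs) [Goal.eq v d] [] 0
  | memberDet_next (F F' : FieldName) (v fs d t : Term) :
      fs.subst σ = Term.cons (Term.field F' d) t → F' ≠ F →
      Reduct P m σ n (Goal.memberDet F v fs) [Goal.memberDet F v t] [] 0
  | replaceDet_unknown (F : FieldName) (v fs fs' : Term) (x : ℕ) : fs.subst σ = Term.var x →
      Reduct P m σ n (Goal.replaceDet fs F v fs')
        [Goal.eq fs (Term.cons (Term.field F (Term.var n)) (Term.var (n + 1))),
          Goal.eq fs' (Term.cons (Term.field F v) (Term.var (n + 1)))] [] 2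
  | replaceDet_found (F : FieldName) (v fs fs' d t : Term) :
      fs.subst σ = Term.cons (Term.field F d) t →
      Reduct P m σ n (Goal.replaceDet fs F v fs')
        [Goal.eq fs' (Term.cons (Term.field F v) t)] [] 0
  | replaceDet_next (F F' : FieldName) (v fs fs' d t : Term) :
      fs.subst σ = Term.cons (Term.field F' d) t → F' ≠ F →
      Reduct P m σ n (Goal.replaceDet fs F v fs')
        [Goal.eq fs' (Term.cons (Term.field F' d) (Term.var n)),
          Goal.replaceDet t F v (Term.var n)] [] 1
  /-- `I = k`, `Xs = [_,…,_,V|_]` with `k` entries before `V` -/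
  | nth0 (i xs v : Term) (k : ℕ) :
      Reduct P m σ n (Goal.nth0 i xs v)
        [Goal.eq i (Term.num k),
          Goal.eq xs
            (Term.listTail (Term.cons v (Term.var (n + k))) (freshVars n k))] [] (k + 1)
  /-- `I = k`, `Xs = [X₁,…,Xₖ,_|Rest]`, `Xs' = [X₁,…,Xₖ,V|Rest]` -/
  | replaceNth0 (xs i v xs' : Term) (k : ℕ) :
      Reduct P m σ n (Goal.replaceNth0 xs i v xs')
        [Goal.eq i (Term.num k),
          Goal.eq xs (Term.listTail
            (Term.cons (Term.var (n + k)) (Term.var (n + k + 1))) (freshVars n k)),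
          Goal.eq xs' (Term.listTail
            (Term.cons v (Term.var (n + k + 1))) (freshVars n k))] [] (k + 2)

/-- Constraint stores `θ`: a substitution `σ` and the constraints `γ`, with `σ` applied. -/
structure Store where
  sub : Subst
  cons : List Constraint

/-- States `⟨G | θ⟩`; the variables from `next` on have not been used yet. -/
structure State where
  goals : List Goal
  store : Store
  next : ℕ

/-- A reduction between states; only satisfiable stores are reached. -/
inductive Step (P : Program) (m : Mode) : State → State → Prop
  | unify (t u : Term) (G : List Goal) (θ : Store) (n : ℕ) (μ : Subst) :
      μ.IsMGU (t.subst θ.sub) (u.subst θ.sub) →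
      Satisfiable (θ.cons.map (Constraint.subst μ)) →
      Step P m ⟨Goal.eq t u :: G, θ, n⟩
        ⟨G, ⟨θ.sub.comp μ, θ.cons.map (Constraint.subst μ)⟩, n⟩
  | reduce (g : Goal) (G gs : List Goal) (cs : List Constraint) (θ : Store) (n k : ℕ) :
      Reduct P m θ.sub n g gs cs k →
      Satisfiable (θ.cons ++ cs.map (Constraint.subst θ.sub)) →
      Step P m ⟨g :: G, θ, n⟩
        ⟨gs ++ G, ⟨θ.sub, θ.cons ++ cs.map (Constraint.subst θ.sub)⟩, n + k⟩

/-- The variables `Args_in`, `Args_out`, `H_in`, `H_out`, `ExFlag` of the initial goal. -/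
abbrev argsIn : ℕ := 0
abbrev argsOut : ℕ := 1
abbrev heapIn : ℕ := 2
abbrev heapOut : ℕ := 3
abbrev exFlag : ℕ := 4

def queryVars : Finset ℕ := {argsIn, argsOut, heapIn, heapOut, exFlag}

/-- The state `⟨m(Args_in,Args_out,H_in,H_out,ExFlag)σ | {}⟩`. -/
def initState (p : PredName) (σ : Subst) : State where
  goals := [Goal.call p (σ argsIn) (σ argsOut) (σ heapIn) (σ heapOut) (σ exFlag)]
  store := ⟨Subst.id, []⟩
  next := varBound (queryVars.biUnion fun x => (σ x).vars)

/-- `⟨m(Args_in,…,ExFlag)σ | {}⟩ → … → ⟨ε | θ⟩`. -/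
def SuccessfulDerivation (P : Program) (m : Mode) (p : PredName) (σ : Subst) (θ : Store) : Prop :=
  ∃ n, Relation.ReflTransGen (Step P m) (initState p σ) ⟨[], θ, n⟩

/-- `⟨ε | θ⟩` ends a successful branch of the symbolic execution of `p`. -/
def SymbolicBranch (P : Program) (p : PredName) (θ : Store) : Prop :=
  SuccessfulDerivation P Mode.symbolic p Subst.id θ

/-- The ground execution of `p(Args_in,…,ExFlag)σ` results in `⟨ε | θ⟩`. -/
def GroundExecution (P : Program) (p : PredName) (σ : Subst) (θ : Store) : Prop :=
  SuccessfulDerivation P Mode.ground p σ θ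

/-- `σ'` is an instantiation of `θ = (σ,γ)`: on the variables of the initial goal `σ' = σρ`
for some `ρ`, and `γρ` is satisfiable. -/
def IsInstantiation (σ' : Subst) (θ : Store) : Prop :=
  ∃ ρ : Subst, (∀ x ∈ queryVars, σ' x = (θ.sub x).subst ρ) ∧
    Satisfiable (θ.cons.map (Constraint.subst ρ))

/-- `θ' ≤ θ`: on the variables of the initial goal the substitution of `θ'` is an instance of
that of `θ`, and whatever values the solutions of `θ'` give to these variables are also given
by a solution of `θ`. -/
def Store.Le (θ' θ : Store) : Prop :=
  (∃ ρ : Subst, ∀ x ∈ queryVars, θ'.sub x = (θ.sub x).subst ρ) ∧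
    ∀ v, IsSolution v θ'.cons → ∃ w, IsSolution w θ.cons ∧
      ∀ x ∈ queryVars, (θ'.sub x).subst v = (θ.sub x).subst w

/-- The output state in terms of the variables `Args_in`, …, `ExFlag` when the derivation that
ends with `θ` was started after applying `σ` to them. -/
def Store.after (σ : Subst) (θ : Store) : Store := ⟨σ.comp θ.sub, θ.cons⟩

end CLP

/-! The two executions are linked by a declarative reading of ground goals, `Derivable`. Fix a
ground solution of the final symbolic constraints that is compatible with the given instantiation.
Under the final substitution followed by this solution, every goal of the branch becomes ground, and
the branch, read backwards, derives each of them (`derivable_of_derivation`). Heap accesses turn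
into membership in a list of cells. The additional symbolic clauses of get_cell are harmless here:
extending an unknown heap and identifying two references both make the membership statement true.

Conversely, a derivable ground call can be executed in ground mode (`Derivable.callSucceeds`). The
derivation acts as an oracle for the choices of clauses, new references and indices: a `Config`
carries, beside the store, a ground valuation predicting the final value of every variable.
Unification succeeds because the prediction is a unifier, and the constraints stay satisfiable
because the prediction solves them. The only conflict is with the cut: get_cell and set_cell commit
to the first cell with the reference, whereas membership allows any. The two agree when no reference
occurs twice. This holds initially by hypothesis, is preserved by allocation because of the
freshness constraint, and by updates because they keep all references.

Prediction alone does not give the comparison of stores, as a solution of the final store could give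
other values to variables left open. Hence the stronger notion `Knows`: the store itself already
makes the term ground. Since variables are defined before use, knowledge spreads from the inputs
through guards and instructions to the outputs. In the end the five query terms are ground with
their predicted values, so every solution of the ground result is matched by the one fixed solution
of the symbolic result. -/

namespace CLP

/-! ### Terms and substitutions -/

namespace Term

theorem subst_subst (t : Term) (σ μ : Subst) : (t.subst σ).subst μ = t.subst (σ.comp μ) := by
  induction t <;> simp_all [subst, Subst.comp]

theorem subst_id (t : Term) : t.subst Subst.id = t := by
  induction t <;> simp_all [subst, Subst.id]

theorem subst_congr {t : Term} {σ μ : Subst} (h : ∀ x ∈ t.vars, σ x = μ x) :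
    t.subst σ = t.subst μ := by
  induction t <;> simp_all [subst, vars]

theorem mem_vars_subst {t : Term} {σ : Subst} {x : ℕ} :
    x ∈ (t.subst σ).vars ↔ ∃ y ∈ t.vars, x ∈ (σ y).vars := by
  induction t <;> simp_all [subst, vars, or_and_right, exists_or]

theorem Ground.subst {t : Term} (h : t.Ground) (σ : Subst) : t.subst σ = t := by
  conv_rhs => rw [← t.subst_id]
  exact subst_congr fun x hx => by simp [show t.vars = ∅ from h] at hx

theorem ground_iff {t : Term} : t.Ground ↔ ∀ x, x ∉ t.vars :=
  Finset.eq_empty_iff_forall_notMem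

theorem ground_subst_iff {t : Term} {σ : Subst} :
    (t.subst σ).Ground ↔ ∀ x ∈ t.vars, (σ x).Ground := by
  simp only [ground_iff, mem_vars_subst]
  grind

@[simp] theorem ground_num (z : ℤ) : (num z).Ground := rfl
@[simp] theorem ground_const (c : Const) : (const c).Ground := rfl
@[simp] theorem ground_fun2 {f : Fun2} {t u : Term} :
    (fun2 f t u).Ground ↔ t.Ground ∧ u.Ground := by simp [Ground, vars]
@[simp] theorem ground_array3 {t u w : Term} :
    (array3 t u w).Ground ↔ t.Ground ∧ u.Ground ∧ w.Ground := by simp [Ground, vars]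

theorem subst_listTail (u : Term) (ts : List Term) (σ : Subst) :
    (listTail u ts).subst σ = listTail (u.subst σ) (ts.map (·.subst σ)) := by
  induction ts <;> simp_all [listTail, subst]

theorem ground_list {ts : List Term} : (list ts).Ground ↔ ∀ t ∈ ts, t.Ground := by
  induction ts <;> simp_all [list]

theorem ground_listTail {u : Term} {ts : List Term} :
    (listTail u ts).Ground ↔ u.Ground ∧ ∀ t ∈ ts, t.Ground := by
  induction ts <;> simp_all [listTail, and_left_comm]

/-- The number of symbols of a term. -/
def size : Term → ℕ
  | var _ => 1
  | num _ => 1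
  | const _ => 1
  | fun1 _ t => t.size + 1
  | fun2 _ t u => t.size + u.size + 1
  | array3 t l xs => t.size + l.size + xs.size + 1

theorem size_pos (t : Term) : 0 < t.size := by cases t <;> simp [size]

theorem size_le_of_mem_vars {t : Term} {x : ℕ} (h : x ∈ t.vars) (ν : Subst) :
    (ν x).size ≤ (t.subst ν).size := by
  induction t <;> simp_all [vars, subst, size] <;> grind

/-- The occurs check: if `x` were a proper subterm of `t`, the instance of `t` would have strictly
more symbols than that of `x`. -/
theorem eq_var_of_unifier {t : Term} {x : ℕ} (h : x ∈ t.vars) {ν : Subst}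
    (hν : t.subst ν = ν x) : t = var x := by
  have key := congrArg size hν
  cases t with
  | var y => simp_all [vars]
  | num z => simp [vars] at h
  | const c => simp [vars] at h
  | fun1 f t =>
    have := size_le_of_mem_vars (t := t) h ν
    simp [subst, size] at key; omega
  | fun2 f t u =>
    simp only [vars, Finset.mem_union] at h
    simp only [subst, size] at key
    rcases h with h | h <;> have := size_le_of_mem_vars h ν <;> omega
  | array3 t l xs =>
    simp only [vars, Finset.mem_union] at h
    simp only [subst, size] at key
    rcases h with (h | h) | h <;> have := size_le_of_mem_vars h ν <;> omega

end Term

theorem Subst.comp_assoc (σ μ ν : Subst) : (σ.comp μ).comp ν = σ.comp (μ.comp ν) := by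
  funext x
  exact Term.subst_subst _ _ _

theorem Subst.comp_id (σ : Subst) : σ.comp Subst.id = σ := by
  funext x
  exact Term.subst_id _

theorem Subst.IsGround.comp (σ : Subst) {ν : Subst} (h : ν.IsGround) : (σ.comp ν).IsGround :=
  fun _ => Term.ground_subst_iff.2 fun y _ => h y

theorem Subst.IsGround.subst {ν : Subst} (h : ν.IsGround) (t : Term) : (t.subst ν).Ground :=
  Term.ground_subst_iff.2 fun y _ => h y

/-! ### Unification -/

/-- `ν` solves all the equations. -/
def Unifies (ν : Subst) (E : List (Term × Term)) : Prop := ∀ p ∈ E, p.1.subst ν = p.2.subst ν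

def eqVars (E : List (Term × Term)) : Finset ℕ :=
  E.foldr (fun p s => p.1.vars ∪ p.2.vars ∪ s) ∅

def eqSize (E : List (Term × Term)) : ℕ := (E.map fun p => p.1.size).sum

theorem mem_eqVars {E : List (Term × Term)} {x : ℕ} :
    x ∈ eqVars E ↔ ∃ p ∈ E, x ∈ p.1.vars ∨ x ∈ p.2.vars := by
  induction E with
  | nil => simp [eqVars]
  | cons p E ih => simp [eqVars, or_assoc] at ih ⊢; grind

/-- `μ` is an idempotent most general unifier of `E` that only uses variables of `E`. -/
structure IsRelevantMGU (μ : Subst) (E : List (Term × Term)) : Prop where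
  unifies : Unifies μ E
  general : ∀ ν, Unifies ν E → μ.comp ν = ν
  outside : ∀ x ∉ eqVars E, μ x = Term.var x
  range : ∀ x ∈ eqVars E, (μ x).vars ⊆ eqVars E

/-- Replacing equations by an equivalent set with fewer variables keeps most general unifiers. -/
theorem IsRelevantMGU.of_equiv {μ : Subst} {E F : List (Term × Term)} (h : IsRelevantMGU μ F)
    (hEF : ∀ ν, Unifies ν E ↔ Unifies ν F) (hv : eqVars F ⊆ eqVars E) : IsRelevantMGU μ E where
  unifies := (hEF μ).2 h.unifies
  general ν hν := h.general ν ((hEF ν).1 hν)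
  outside x hx := h.outside x fun hx' => hx (hv hx')
  range x hx := by
    by_cases hx' : x ∈ eqVars F
    · exact (h.range x hx').trans hv
    · rw [h.outside x hx']; simpa [Term.vars] using hx

/-- The substitution that binds only `x`. -/
def Subst.single (x : ℕ) (u : Term) : Subst := Function.update Subst.id x u

theorem Subst.single_comp {x : ℕ} {u : Term} {ν : Subst} (h : u.subst ν = ν x) :
    (Subst.single x u).comp ν = ν := by
  funext y
  by_cases hy : y = x
  · subst hy; simpa [Subst.comp, Subst.single] using h
  · simp [Subst.comp, Subst.single, hy, Subst.id, Term.subst]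

theorem Term.subst_single_of_notMem {x : ℕ} {u t : Term} (h : x ∉ t.vars) :
    t.subst (Subst.single x u) = t := by
  conv_rhs => rw [← t.subst_id]
  refine Term.subst_congr fun y hy => ?_
  have : y ≠ x := by rintro rfl; exact h hy
  simp [Subst.single, this]

theorem Term.mem_vars_subst_single {x y : ℕ} {u t : Term} (hu : x ∉ u.vars)
    (h : y ∈ (t.subst (Subst.single x u)).vars) :
    y ≠ x ∧ (y ∈ t.vars ∨ y ∈ u.vars) := by
  obtain ⟨z, hz, hy⟩ := Term.mem_vars_subst.1 h
  by_cases hzx : z = x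
  · subst hzx
    simp only [Subst.single, Function.update_self] at hy
    exact ⟨fun hh => hu (hh ▸ hy), Or.inr hy⟩
  · simp only [Subst.single, Function.update_of_ne hzx, Subst.id, Term.vars,
      Finset.mem_singleton] at hy
    subst hy
    exact ⟨hzx, Or.inl hz⟩

def substEqs (σ : Subst) (E : List (Term × Term)) : List (Term × Term) :=
  E.map fun p => (p.1.subst σ, p.2.subst σ)

theorem unifies_substEqs {σ ν : Subst} {E : List (Term × Term)} :
    Unifies ν (substEqs σ E) ↔ Unifies (σ.comp ν) E := by
  simp only [Unifies, substEqs, List.forall_mem_map, Term.subst_subst]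

theorem unifies_cons {ν : Subst} {p : Term × Term} {E : List (Term × Term)} :
    Unifies ν (p :: E) ↔ p.1.subst ν = p.2.subst ν ∧ Unifies ν E := by
  simp [Unifies]

theorem eqVars_substEqs_subset {x : ℕ} {u : Term} {E : List (Term × Term)} (hx : x ∉ u.vars) :
    eqVars (substEqs (Subst.single x u) E) ⊆ eqVars ((Term.var x, u) :: E) := by
  intro y hy
  obtain ⟨p, hp, hy⟩ := mem_eqVars.1 hy
  obtain ⟨q, hq, rfl⟩ := List.mem_map.1 hp
  refine mem_eqVars.2 ?_
  rcases hy with hy | hy <;> obtain ⟨-, h1 | h1⟩ := Term.mem_vars_subst_single hx hy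
  · exact ⟨q, by simp [hq], Or.inl h1⟩
  · exact ⟨_, List.mem_cons_self, Or.inr h1⟩
  · exact ⟨q, by simp [hq], Or.inr h1⟩
  · exact ⟨_, List.mem_cons_self, Or.inr h1⟩

/-- Eliminating the variable of a solved equation. -/
theorem IsRelevantMGU.eliminate {μ : Subst} {x : ℕ} {u : Term} {E : List (Term × Term)}
    (hx : x ∉ u.vars) (h : IsRelevantMGU μ (substEqs (Subst.single x u) E)) :
    IsRelevantMGU ((Subst.single x u).comp μ) ((Term.var x, u) :: E) := by
  have hsub := eqVars_substEqs_subset (E := E) hx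
  have hμ : ∀ y ∈ eqVars ((Term.var x, u) :: E),
      (μ y).vars ⊆ eqVars ((Term.var x, u) :: E) := by
    intro y hy
    by_cases hy' : y ∈ eqVars (substEqs (Subst.single x u) E)
    · exact fun z hz => hsub (h.range y hy' hz)
    · rw [h.outside y hy']; simpa [Term.vars] using hy
  refine ⟨?_, ?_, ?_, ?_⟩
  · rw [unifies_cons, ← unifies_substEqs]
    refine ⟨?_, h.unifies⟩
    simp only [← Term.subst_subst, Term.subst_single_of_notMem hx]
    simp [Term.subst, Subst.single]
  · intro ν hν
    rw [unifies_cons] at hν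
    have h1 : (Subst.single x u).comp ν = ν := Subst.single_comp hν.1.symm
    -- A unifier of the solved equation absorbs the binding of `x`. It therefore also unifies the
    -- reduced system, to which generality applies.
    rw [Subst.comp_assoc, h.general ν, h1]
    rw [unifies_substEqs, h1]
    exact hν.2
  · intro y hy
    have hyx : y ≠ x := by
      rintro rfl
      exact hy (mem_eqVars.2 ⟨_, List.mem_cons_self, by simp [Term.vars]⟩)
    simp only [Subst.comp, Subst.single, Function.update_of_ne hyx, Subst.id, Term.subst]
    exact h.outside y fun h' => hy (hsub h')
  · intro y hy z hz
    obtain ⟨w, hw, hz⟩ := Term.mem_vars_subst.1 hz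
    refine hμ w ?_ hz
    by_cases hyx : y = x
    · subst hyx
      simp only [Subst.single, Function.update_self] at hw
      exact mem_eqVars.2 ⟨_, List.mem_cons_self, Or.inr hw⟩
    · simp only [Subst.single, Function.update_of_ne hyx, Subst.id, Term.vars,
        Finset.mem_singleton] at hw
      exact hw ▸ hy

theorem card_eqVars_substEqs_lt {x : ℕ} {u : Term} {E : List (Term × Term)} (hx : x ∉ u.vars) :
    (eqVars (substEqs (Subst.single x u) E)).card < (eqVars ((Term.var x, u) :: E)).card := by
  refine Finset.card_lt_card ((Finset.ssubset_iff_of_subset ?_).2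
    ⟨x, mem_eqVars.2 ⟨_, List.mem_cons_self, by simp [Term.vars]⟩, ?_⟩)
  · exact eqVars_substEqs_subset hx
  · intro hy
    obtain ⟨p, hp, hy⟩ := mem_eqVars.1 hy
    obtain ⟨q, hq, rfl⟩ := List.mem_map.1 hp
    rcases hy with hy | hy <;> exact (Term.mem_vars_subst_single hx hy).1 rfl

/-- Robinson's algorithm as a lexicographic induction on the number of variables and the number of
symbols on the left-hand sides. Eliminating a variable lowers the first, even if it enlarges terms;
deleting or decomposing an equation adds no variable and lowers the second. The given unifier rules
out clashes and failures of the occurs check. -/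
theorem exists_relevantMGU_aux (N : ℕ) : ∀ (s : ℕ) (E : List (Term × Term)),
    (eqVars E).card ≤ N → eqSize E ≤ s → (∃ ν, Unifies ν E) → ∃ μ, IsRelevantMGU μ E := by
  induction N using Nat.strong_induction_on with
  | _ N ihN =>
  intro s
  induction s with
  | zero =>
    intro E _ hs _
    cases E with
    | nil =>
      exact ⟨Subst.id, by simp [Unifies], fun ν _ => by funext x; rfl, fun x _ => rfl,
        by simp [eqVars]⟩
    | cons p E =>
      have := p.1.size_pos
      simp [eqSize] at hs
      omega
  | succ s ihs =>
    intro E hN hs hν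
    obtain ⟨ν, hν⟩ := hν
    have elim : ∀ (x : ℕ) (u : Term) (F : List (Term × Term)), u ≠ Term.var x →
        (∀ ν, Unifies ν E ↔ Unifies ν ((Term.var x, u) :: F)) →
        eqVars ((Term.var x, u) :: F) = eqVars E → ∃ μ, IsRelevantMGU μ E := by
      intro x u F hu hE hv
      have hν' := (hE ν).1 hν
      rw [unifies_cons] at hν'
      have hx : x ∉ u.vars := fun h => hu (Term.eq_var_of_unifier h hν'.1.symm)
      have hlt := card_eqVars_substEqs_lt (E := F) hx
      obtain ⟨μ, hμ⟩ := ihN _ (by rw [hv] at hlt; exact lt_of_lt_of_le hlt hN)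
        (eqSize (substEqs (Subst.single x u) F)) (substEqs (Subst.single x u) F) le_rfl le_rfl
        ⟨ν, by rw [unifies_substEqs, Subst.single_comp hν'.1.symm]; exact hν'.2⟩
      exact ⟨_, (hμ.eliminate hx).of_equiv hE hv.subset⟩
    have step : ∀ F : List (Term × Term), (∀ ν, Unifies ν E ↔ Unifies ν F) →
        eqVars F ⊆ eqVars E → eqSize F < eqSize E → ∃ μ, IsRelevantMGU μ E := by
      intro F hE hv hF
      obtain ⟨μ, hμ⟩ := ihs F ((Finset.card_le_card hv).trans hN) (by omega) ⟨ν, (hE ν).1 hν⟩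
      exact ⟨μ, hμ.of_equiv hE hv⟩
    cases E with
    | nil =>
      exact ⟨Subst.id, by simp [Unifies], fun ν _ => by funext x; rfl, fun x _ => rfl,
        by simp [eqVars]⟩
    | cons p E =>
    obtain ⟨t, u⟩ := p
    by_cases htu : t = u
    · refine step E (fun ν => by simp [unifies_cons, htu]) ?_ ?_
      · intro x; simp only [mem_eqVars]; rintro ⟨p, hp, h⟩; exact ⟨p, by simp [hp], h⟩
      · have := t.size_pos
        simp [eqSize]; omega
    have hh := (unifies_cons.1 hν).1
    by_cases ht : ∃ x, t = Term.var x
    · obtain ⟨x, rfl⟩ := ht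
      exact elim x u E (Ne.symm htu) (fun _ => Iff.rfl) rfl
    by_cases hu : ∃ x, u = Term.var x
    · obtain ⟨x, rfl⟩ := hu
      -- Swapping the sides is harmless for the measure, because the elimination that follows lowers
      -- the number of variables.
      refine elim x t E htu (fun _ => ?_) ?_
      · simp only [unifies_cons]; grind
      · simp [eqVars, Finset.union_comm]
    -- The common instance under `ν` excludes different outermost symbols.
    cases t <;> cases u <;> simp [Term.subst] at hh htu ht hu
    · exact absurd hh htu
    · exact absurd hh htu
    · obtain ⟨rfl, -⟩ := hh
      rename_i f t u
      refine step ((t, u) :: E) (fun ν => ?_) ?_ ?_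
      · simp [unifies_cons, Term.subst]
      · simp [eqVars, Term.vars]
      · simp [eqSize, Term.size]
    · obtain ⟨rfl, -⟩ := hh
      rename_i f t₁ t₂ u₁ u₂
      refine step ((t₁, u₁) :: (t₂, u₂) :: E) (fun ν => ?_) ?_ ?_
      · simp [unifies_cons, Term.subst, and_assoc]
      · intro x; simp only [eqVars, Term.vars, List.foldr, Finset.mem_union]; tauto
      · simp [eqSize, Term.size]; omega
    · rename_i t₁ t₂ t₃ u₁ u₂ u₃
      refine step ((t₁, u₁) :: (t₂, u₂) :: (t₃, u₃) :: E) (fun ν => ?_) ?_ ?_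
      · simp [unifies_cons, Term.subst, and_assoc]
      · intro x; simp only [eqVars, Term.vars, List.foldr, Finset.mem_union]; tauto
      · simp [eqSize, Term.size]; omega

/-- Unifiable terms have an idempotent most general unifier that stays within any bound on
their variables. -/
theorem exists_isMGU {t u : Term} {ν : Subst} (h : t.subst ν = u.subst ν) {n : ℕ}
    (ht : ∀ x ∈ t.vars, x < n) (hu : ∀ x ∈ u.vars, x < n) :
    ∃ μ : Subst, μ.IsMGU t u ∧ (∀ x, n ≤ x → μ x = Term.var x) ∧
      ∀ x < n, ∀ y ∈ (μ x).vars, y < n := by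
  obtain ⟨μ, hμ⟩ := exists_relevantMGU_aux _ _ [(t, u)] le_rfl le_rfl
    ⟨ν, by simpa [Unifies] using h⟩
  have hv : ∀ x, x ∈ eqVars [(t, u)] → x < n := by
    simp only [mem_eqVars]; simp only [List.mem_singleton, exists_eq_left]; grind
  refine ⟨μ, ⟨by simpa [Unifies] using hμ.unifies, fun ν hν x => ?_⟩, fun x hx => ?_,
    fun x hx y hy => ?_⟩
  · exact congrFun (hμ.general ν (by simpa [Unifies] using hν)) x
  · exact hμ.outside x fun h => absurd (hv x h) (by omega)
  · by_cases hx' : x ∈ eqVars [(t, u)]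
    · exact hv y (hμ.range x hx' hy)
    · rw [hμ.outside x hx'] at hy
      simp only [Term.vars, Finset.mem_singleton] at hy
      omega

/-! ### Declarative semantics of ground goals -/

/-- The heap `h` lists the cell `(r,c)`. -/
inductive MemCell : Term → Term → Term → Prop
  | head (r c t : Term) : MemCell (Term.cons (Term.loc r c) t) r c
  | tail (d t r c : Term) : MemCell t r c → MemCell (Term.cons d t) r c

/-- `h'` arises from `h` by replacing a cell with reference `r` by `(r,c)`. -/
inductive ReplaceCell : Term → Term → Term → Term → Prop
  | head (r c c' t : Term) :
      ReplaceCell (Term.cons (Term.loc r c') t) r c (Term.cons (Term.loc r c) t)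
  | tail (d t r c t' : Term) :
      ReplaceCell t r c t' → ReplaceCell (Term.cons d t) r c (Term.cons d t')

/-- The first entry of the list of fields with name `F` is `v`. -/
inductive FirstField (F : FieldName) (v : Term) : Term → Prop
  | head (t : Term) : FirstField F v (Term.cons (Term.field F v) t)
  | tail (F' : FieldName) (d t : Term) : F' ≠ F → FirstField F v t →
      FirstField F v (Term.cons (Term.field F' d) t)

/-- Replacing the first entry with name `F` by `v`. -/
inductive ReplaceField (F : FieldName) (v : Term) : Term → Term → Prop
  | head (d t : Term) :
      ReplaceField F v (Term.cons (Term.field F d) t) (Term.cons (Term.field F v) t)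
  | tail (F' : FieldName) (d t t' : Term) : F' ≠ F → ReplaceField F v t t' →
      ReplaceField F v (Term.cons (Term.field F' d) t) (Term.cons (Term.field F' d) t')

def HasElem (i xs v : Term) : Prop :=
  ∃ (ys : List Term) (rest : Term),
    i = Term.num ys.length ∧ xs = Term.listTail (Term.cons v rest) ys

def ReplaceElem (xs i v xs' : Term) : Prop :=
  ∃ (ys : List Term) (d rest : Term), i = Term.num ys.length ∧
    xs = Term.listTail (Term.cons d rest) ys ∧ xs' = Term.listTail (Term.cons v rest) ys

def IsDefaultObject (P : Program) (c ob : Term) : Prop :=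
  ∃ C fs, P.FieldsOf C fs ∧ c = Term.cls C ∧ ob = Term.object (Term.cls C) (initFields fs)

def IsDefaultArray (T : Ty) (l ar : Term) : Prop :=
  ∃ k : ℕ, l = Term.num k ∧
    ar = Term.array3 T.toTerm l (Term.list (List.replicate k T.default))

def IsSubclassTerm (P : Program) (t : Term) (C : ClassName) : Prop :=
  ∃ D, P.Subclass D C ∧ t = Term.cls D

def IsNewRef (h r : Term) : Prop := ∃ k : ℤ, r = Term.num k ∧ Term.num k ∉ h.locs

/-- Truth of a ground goal other than a call. -/
def Goal.IsTrue (P : Program) : Goal → Prop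
  | eq t u => t = u
  | call _ _ _ _ _ _ => False
  | rel op t u => ∃ a b, t = Term.num a ∧ u = Term.num b ∧ op.Holds a b
  | arith op x t u =>
      ∃ a b c, t = Term.num a ∧ u = Term.num b ∧ x = Term.num c ∧ op.eval a b = some c
  | neq t u => t ≠ u
  | type h r t => ∃ fs, MemCell h r (Term.object t fs)
  | newObject h c r h' => ∃ ob, IsDefaultObject P c ob ∧ IsNewRef h r ∧
      h' = Term.cons (Term.loc r ob) h
  | newArray h T l r h' => ∃ ar, IsDefaultArray T l ar ∧ IsNewRef h r ∧
      h' = Term.cons (Term.loc r ar) h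
  | length h r l => ∃ T xs, MemCell h r (Term.array3 T l xs)
  | getField h r C F v => ∃ T fs, MemCell h r (Term.object T fs) ∧ IsSubclassTerm P T C ∧
      FirstField F v fs
  | setField h r C F v h' => ∃ T fs fs', MemCell h r (Term.object T fs) ∧
      IsSubclassTerm P T C ∧ ReplaceField F v fs fs' ∧ ReplaceCell h r (Term.object T fs') h'
  | getArray h r i v => ∃ T l xs, MemCell h r (Term.array3 T l xs) ∧ HasElem i xs v
  | setArray h r i v h' => ∃ T l xs xs', MemCell h r (Term.array3 T l xs) ∧
      ReplaceElem xs i v xs' ∧ ReplaceCell h r (Term.array3 T l xs') h'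
  | getCell h r c => MemCell h r c
  | setCell h r c h' => ReplaceCell h r c h'
  | newRef h r => IsNewRef h r
  | buildObject c ob => IsDefaultObject P c ob
  | buildArray T l ar => IsDefaultArray T l ar
  | subclass t C => IsSubclassTerm P t C
  | memberDet F v fs => FirstField F v fs
  | replaceDet fs F v fs' => ReplaceField F v fs fs'
  | nth0 i xs v => HasElem i xs v
  | replaceNth0 xs i v xs' => ReplaceElem xs i v xs'

/-- Derivability of ground goals. -/
inductive Derivable (P : Program) : Goal → Prop
  | prim (g : Goal) : g.IsTrue P → Derivable P g
  | call (c : Clause) (τ : Subst) : c ∈ P.clauses → τ.IsGround →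
      (∀ g ∈ c.rhs, Derivable P (g.subst τ)) →
      Derivable P (Goal.call c.pred ((Term.list c.argsIn).subst τ)
        ((Term.list c.argsOut).subst τ) (τ c.heapIn) (τ c.heapOut) (c.exFlag.subst τ))

def Goal.isCall : Goal → Bool
  | call _ _ _ _ _ _ => true
  | _ => false

theorem Goal.isCall_subst (g : Goal) (σ : Subst) : (g.subst σ).isCall = g.isCall := by
  cases g <;> rfl

theorem Derivable.true {P : Program} {g : Goal} (h : Derivable P g) (hg : g.isCall = false) :
    g.IsTrue P := by
  cases h with
  | prim g h => exact h
  | call c τ _ _ _ => cases hg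

theorem Goal.subst_subst (g : Goal) (σ μ : Subst) :
    (g.subst σ).subst μ = g.subst (σ.comp μ) := by
  cases g <;> simp only [Goal.subst, Term.subst_subst]

theorem Constraint.holds_subst {c : Constraint} {σ v : Subst} :
    (c.subst σ).Holds v ↔ c.Holds (σ.comp v) := by
  cases c <;> simp only [Constraint.subst, Constraint.Holds, Term.subst_subst]

theorem initFields_ground (fs : List (FieldName × Ty)) : (initFields fs).Ground := by
  rw [initFields, Term.ground_list]
  simp only [List.mem_map, forall_exists_index, and_imp, forall_apply_eq_imp_iff₂]
  rintro ⟨F, T⟩ -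
  cases T <;> rfl

theorem Ty.default_ground (T : Ty) : T.default.Ground := by cases T <;> rfl

theorem Ty.toTerm_ground (T : Ty) : T.toTerm.Ground := by
  induction T with
  | arr T ih => exact ih
  | _ => rfl

theorem Ty.defaults_ground (T : Ty) (k : ℕ) :
    (Term.list (List.replicate k T.default)).Ground :=
  Term.ground_list.2 fun _ h => (List.eq_of_mem_replicate h) ▸ T.default_ground

/-! ### Soundness of derivations -/

/-- Reductions inspect terms under the current substitution `σ`. As `τ` refines `σ`, the shape found
there persists under `τ`. -/
theorem subst_of_subst_eq {σ τ : Subst} {t u : Term} (hτ : σ.comp τ = τ)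
    (h : t.subst σ = u) : t.subst τ = u.subst τ := by
  rw [← h, Term.subst_subst, hτ]

/-- Read as an implication from the new goals to the replaced one, each rule is sound in both modes.
The values under `τ` of the variables that the rule introduces serve as existential witnesses, or as
the instance of the clause. -/
theorem Reduct.derivable {P : Program} {m : Mode} {σ τ : Subst} {n k : ℕ} {g : Goal}
    {gs : List Goal} {cs : List Constraint} (hr : Reduct P m σ n g gs cs k)
    (hτ : σ.comp τ = τ) (hground : τ.IsGround) (hgs : ∀ g ∈ gs, Derivable P (g.subst τ))
    (hcs : ∀ c ∈ cs, c.Holds τ) : Derivable P (g.subst τ) := by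
  have htrue : ∀ g ∈ gs, g.isCall = false → (g.subst τ).IsTrue P := fun g hg h =>
    (hgs g hg).true (g.isCall_subst τ ▸ h)
  cases hr
  case call c a o h h' e hc =>
    simp only [Clause.headEqs, List.forall_mem_append] at hgs htrue
    have h2 := hgs.2
    have h1 := htrue.1
    simp only [List.forall_mem_cons, Goal.isCall, Goal.subst, Goal.IsTrue, forall_const,
      Term.subst_subst] at h1
    simp only [List.forall_mem_map, Goal.subst_subst] at h2
    obtain ⟨ha, ho, hh, hh', he, -⟩ := h1
    rw [Goal.subst, ha, ho, hh, hh', he]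
    exact Derivable.call c _ hc (.comp _ hground) h2
  all_goals
    refine .prim _ ?_
    clear hgs
    rename' htrue => hgs
    simp only [List.forall_mem_cons, List.not_mem_nil, false_imp_iff, implies_true, Goal.subst,
      Goal.isCall, forall_const, Goal.IsTrue, and_true, Term.subst, Constraint.Holds] at hgs hcs ⊢
  case rel op t u => exact hcs
  case neq t u => exact hcs
  case arith_eval op x t u a b c ht hu he =>
    exact ⟨a, b, c, subst_of_subst_eq hτ ht, subst_of_subst_eq hτ hu, hgs, he⟩
  case arith_post op x t u _ => exact hcs
  case type h r t => exact ⟨_, hgs.2 ▸ hgs.1⟩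
  case newObject h c r h' => exact ⟨_, hgs⟩
  case newArray h T l r h' => exact ⟨_, hgs⟩
  case length h r l => exact ⟨_, _, hgs.2 ▸ hgs.1⟩
  case getField h r C F v => exact ⟨_, _, by simpa only [hgs.2.1] using hgs.1, hgs.2.2⟩
  case setField h r C F v h' => exact 
    ⟨_, _, _, by simpa only [hgs.2.1] using hgs.1, hgs.2.2⟩
  case getArray h r i v => exact ⟨_, _, _, hgs.2.1 ▸ hgs.1, hgs.2.2⟩
  case setArray h r i v h' => exact ⟨_, _, _, _, hgs.2.1 ▸ hgs.1, hgs.2.2⟩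
  case getCell_unknown h r c x hm hh => exact hgs ▸ .head _ _ _
  case getCell_found h r c r' c' t hh hr =>
    rw [subst_of_subst_eq hτ hh, subst_of_subst_eq hτ hr, hgs]
    exact .head _ _ _
  case getCell_alias h r c c' t x y hm hh hr hxy =>
    rw [subst_of_subst_eq hτ hh, hgs.1, hgs.2]
    exact .head _ _ _
  case getCell_next h r c d t hh hd =>
    rw [subst_of_subst_eq hτ hh]
    exact .tail _ _ _ _ hgs
  case setCell_found h r c h' r' c' t hh hr =>
    rw [subst_of_subst_eq hτ hh, hgs, subst_of_subst_eq hτ hr]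
    exact .head _ _ _ _
  case setCell_next h r c h' d t hh hd =>
    rw [subst_of_subst_eq hτ hh, hgs.1]
    exact .tail _ _ _ _ _ hgs.2
  case newRef h r k => exact ⟨k, hgs, hcs⟩
  case buildObject c ob C fs hfs =>
    exact ⟨C, fs, hfs, hgs.1, by rw [hgs.2, (initFields_ground fs).subst]⟩
  case buildArray T l ar k =>
    exact ⟨k, hgs.1, by rw [hgs.2, T.toTerm_ground.subst, (T.defaults_ground k).subst]⟩
  case subclass t C D h => exact ⟨D, h, hgs⟩
  case memberDet_unknown F v fs x hfs => exact hgs ▸ .head _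
  case memberDet_found F v fs d t hfs =>
    rw [subst_of_subst_eq hτ hfs, hgs]
    exact .head _
  case memberDet_next F F' v fs d t hfs hF =>
    rw [subst_of_subst_eq hτ hfs]
    exact .tail _ _ _ hF hgs
  case replaceDet_unknown F v fs fs' x hfs =>
    rw [hgs.1, hgs.2]
    exact .head _ _
  case replaceDet_found F v fs fs' d t hfs =>
    rw [subst_of_subst_eq hτ hfs, hgs]
    exact .head _ _
  case replaceDet_next F F' v fs fs' d t hfs hF =>
    rw [subst_of_subst_eq hτ hfs, hgs.1]
    exact .tail _ _ _ _ hF hgs.2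
  case nth0 i xs v k =>
    refine ⟨(freshVars n k).map (·.subst τ), τ (n + k), ?_, ?_⟩
    · simpa [freshVars] using hgs.1
    · rw [hgs.2, Term.subst_listTail]; rfl
  case replaceNth0 xs i v xs' k =>
    refine ⟨(freshVars n k).map (·.subst τ), τ (n + k), τ (n + k + 1), ?_, ?_, ?_⟩
    · simpa [freshVars] using hgs.1
    · rw [hgs.2.1, Term.subst_listTail]; rfl
    · rw [hgs.2.2, Term.subst_listTail]; rfl

/-- Along a derivation to the empty goal, a solution of the last store is propagated back to
a solution of every earlier store that gives the same values to all variables. -/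
theorem derivable_of_derivation {P : Program} {m : Mode} {θ : Store} {k : ℕ} {S : State}
    (hS : Relation.ReflTransGen (Step P m) S ⟨[], θ, k⟩) {ν : Subst}
    (hν : IsSolution ν θ.cons) (hid : S.store.sub.comp S.store.sub = S.store.sub) :
    (∃ ν₀, IsSolution ν₀ S.store.cons ∧ S.store.sub.comp ν₀ = θ.sub.comp ν) ∧
      ∀ g ∈ S.goals, Derivable P (g.subst (θ.sub.comp ν)) := by
  induction hS using Relation.ReflTransGen.head_induction_on with
  | refl => exact ⟨⟨ν, hν, rfl⟩, by simp⟩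
  | head h _ ih =>
    cases h with
    | unify t u G σ n μ hμ hsat =>
      -- As the old substitution is idempotent, its composite with `μ` still unifies the two
      -- instances. Generality of `μ` then makes that composite, the new store substitution,
      -- idempotent too.
      have hgen : μ.comp (σ.sub.comp μ) = σ.sub.comp μ := by
        funext x
        refine hμ.2 _ ?_ x
        simp only [← Term.subst_subst] at hid ⊢
        simp only [Term.subst_subst, hid]
        simpa only [Term.subst_subst] using hμ.1
      obtain ⟨⟨ν₀, hν₀, hτ⟩, hG⟩ := ih (by
        show (σ.sub.comp μ).comp (σ.sub.comp μ) = σ.sub.comp μ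
        rw [Subst.comp_assoc, hgen, ← Subst.comp_assoc, hid])
      simp only at hτ hν₀ hG ⊢
      rw [Subst.comp_assoc] at hτ
      refine ⟨⟨μ.comp ν₀, ⟨Subst.IsGround.comp _ hν₀.1, fun c hc => ?_⟩, hτ⟩, ?_⟩
      · exact Constraint.holds_subst.1 (hν₀.2 _ (List.mem_map_of_mem hc))
      · rw [List.forall_mem_cons]
        refine ⟨.prim _ ?_, hG⟩
        have h := congrArg (Term.subst ν₀) hμ.1
        simp only [Term.subst_subst, Subst.comp_assoc, hτ] at h
        exact h
    | reduce g G gs cs σ n k hr hsat =>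
      obtain ⟨⟨ν₀, hν₀, hτ⟩, hG⟩ := ih hid
      simp only [List.forall_mem_append] at hτ hν₀ hG hid ⊢
      refine ⟨⟨ν₀, ⟨hν₀.1, fun c hc => hν₀.2 c (List.mem_append_left _ hc)⟩, hτ⟩, ?_⟩
      rw [List.forall_mem_cons]
      -- The final valuation factors through the current store substitution, so idempotence shows
      -- that it refines that substitution.
      refine ⟨hr.derivable ?_ (.comp _ hν.1) hG.1 fun c hc => ?_, hG.2⟩
      · rw [← hτ, ← Subst.comp_assoc, hid]
      · rw [← hτ, ← Constraint.holds_subst]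
        exact hν₀.2 _ (List.mem_append_right _ (List.mem_map_of_mem hc))

/-! ### Ground execution: configurations and runs -/

/-- A store of the ground execution together with the values that its variables will get. -/
structure Config where
  store : Store
  next : ℕ
  val : Subst

namespace Config

/-- The valuation refines the store (`fix`), and variables from `next` on are neither bound nor
mentioned (`dom`, `range`), so that their values can be chosen later. For the same reason `cons`
demands truth under every valuation that agrees with `val` on the used variables: it must survive a
reassignment of the others. -/
structure Valid (C : Config) : Prop where
  ground : C.val.IsGround
  fix : C.store.sub.comp C.val = C.val
  dom : ∀ x, C.next ≤ x → C.store.sub x = Term.var x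
  range : ∀ x < C.next, ∀ y ∈ (C.store.sub x).vars, y < C.next
  cons : ∀ δ : Subst, (∀ x < C.next, δ x = C.val x) → ∀ c ∈ C.store.cons, c.Holds δ

/-- `t` only uses old variables, and its final value is `a`. -/
def Has (C : Config) (t a : Term) : Prop :=
  (∀ x ∈ t.vars, x < C.next) ∧ t.subst C.val = a

/-- The store determines the value `a` of `t`. -/
def Knows (C : Config) (t a : Term) : Prop := C.Has t a ∧ (t.subst C.store.sub).Ground

variable {C : Config} {t u a b : Term}

theorem Has.ground (h : C.Has t a) (hC : C.Valid) : a.Ground := h.2 ▸ hC.ground.subst t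

theorem Knows.ground (h : C.Knows t a) (hC : C.Valid) : a.Ground := h.1.ground hC

/-- A ground instance is not changed by the valuation, so what the store has computed is the
predicted value. -/
theorem Knows.subst_eq (h : C.Knows t a) (hC : C.Valid) : t.subst C.store.sub = a := by
  rw [← h.1.2, ← hC.fix, ← Term.subst_subst, h.2.subst]

theorem has_of_ground (h : a.Ground) : C.Has a a :=
  ⟨by simp [show a.vars = ∅ from h], h.subst _⟩

theorem knows_of_ground (h : a.Ground) : C.Knows a a :=
  ⟨has_of_ground h, by rwa [h.subst]⟩

theorem Knows.mono (h : C.Knows t a) (hu : C.Has u b) (hv : u.vars ⊆ t.vars) : C.Knows u b :=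
  ⟨hu, Term.ground_subst_iff.2 fun x hx => Term.ground_subst_iff.1 h.2 x (hv hx)⟩

theorem Has.fun2 {f : Fun2} (ht : C.Has t a) (hu : C.Has u b) :
    C.Has (.fun2 f t u) (.fun2 f a b) := by
  refine ⟨?_, by rw [Term.subst, ht.2, hu.2]⟩
  simp only [Term.vars, Finset.mem_union]
  exact fun x hx => hx.elim (ht.1 x) (hu.1 x)

theorem Knows.fun2 {f : Fun2} (ht : C.Knows t a) (hu : C.Knows u b) :
    C.Knows (.fun2 f t u) (.fun2 f a b) :=
  ⟨ht.1.fun2 hu.1, Term.ground_fun2.2 ⟨ht.2, hu.2⟩⟩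

theorem Has.array3 {s d : Term} (ht : C.Has t a) (hu : C.Has u b) (hs : C.Has s d) :
    C.Has (.array3 t u s) (.array3 a b d) := by
  refine ⟨?_, by rw [Term.subst, ht.2, hu.2, hs.2]⟩
  simp only [Term.vars, Finset.mem_union]
  exact fun x hx => hx.elim (fun hx => hx.elim (ht.1 x) (hu.1 x)) (hs.1 x)

theorem Knows.array3 {s d : Term} (ht : C.Knows t a) (hu : C.Knows u b) (hs : C.Knows s d) :
    C.Knows (.array3 t u s) (.array3 a b d) :=
  ⟨ht.1.array3 hu.1 hs.1, Term.ground_array3.2 ⟨ht.2, hu.2, hs.2⟩⟩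

theorem Knows.of_eq (ht : C.Has t a) (hu : C.Knows u b)
    (h : t.subst C.store.sub = u.subst C.store.sub) : C.Knows t a := ⟨ht, h ▸ hu.2⟩

/-- Taking `k` fresh variables with values `w` and posting the constraints `cs`. -/
def post (C : Config) (k : ℕ) (w : Subst) (cs : List Constraint) : Config where
  store := ⟨C.store.sub, C.store.cons ++ cs.map (Constraint.subst C.store.sub)⟩
  next := C.next + k
  -- All variables from `C.next` on are reset, not only the `k` taken; the later ones stay open to
  -- another choice.
  val := fun x => if x < C.next then C.val x else w (x - C.next)

variable {k : ℕ} {w : Subst} {cs : List Constraint}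

theorem post_val_of_lt {x : ℕ} (h : x < C.next) : (C.post k w cs).val x = C.val x := by
  simp [post, h]

theorem post_val_add {i : ℕ} : (C.post k w cs).val (C.next + i) = w i := by
  simp [post]

theorem subst_congr_of_agree {δ : Subst} (ht : ∀ x ∈ t.vars, x < C.next)
    (h : ∀ x < C.next, δ x = C.val x) : t.subst δ = t.subst C.val :=
  Term.subst_congr fun x hx => h x (ht x hx)

theorem Valid.comp_agree (hC : C.Valid) {δ : Subst} (h : ∀ x < C.next, δ x = C.val x) :
    ∀ x < C.next, C.store.sub.comp δ x = C.val x := by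
  intro x hx
  rw [← congrFun hC.fix x]
  exact subst_congr_of_agree (hC.range x hx) h

theorem Valid.post (hC : C.Valid) (hw : w.IsGround)
    (hcs : ∀ δ : Subst, (∀ x < C.next, δ x = C.val x) → ∀ c ∈ cs, c.Holds δ) :
    (C.post k w cs).Valid where
  ground x := by
    simp only [Config.post]
    split
    · exact hC.ground x
    · exact hw _
  fix := by
    funext x
    by_cases hx : x < C.next
    · rw [post_val_of_lt hx]
      exact hC.comp_agree (fun y hy => post_val_of_lt hy) x hx
    · show (C.store.sub x).subst _ = _
      rw [hC.dom x (not_lt.1 hx)]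
      rfl
  dom x hx := hC.dom x ((Nat.le_add_right _ _).trans hx)
  range x hx y hy := by
    simp only [Config.post] at hx hy ⊢
    by_cases hx' : x < C.next
    · exact (hC.range x hx' y hy).trans_le (Nat.le_add_right _ _)
    · rw [hC.dom x (not_lt.1 hx')] at hy
      simp only [Term.vars, Finset.mem_singleton] at hy
      omega
  cons δ hδ c hc := by
    have hδ' : ∀ x < C.next, δ x = C.val x := fun x hx => by
      rw [hδ x (hx.trans_le (Nat.le_add_right _ _)), post_val_of_lt hx]
    rcases List.mem_append.1 hc with hc | hc
    · exact hC.cons δ hδ' c hc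
    · obtain ⟨d, hd, rfl⟩ := List.mem_map.1 hc
      rw [Constraint.holds_subst]
      exact hcs _ (hC.comp_agree hδ') d hd

theorem Has.post (h : C.Has t a) : (C.post k w cs).Has t a :=
  ⟨fun x hx => (h.1 x hx).trans_le (Nat.le_add_right _ _), by
    rw [← h.2]; exact subst_congr_of_agree h.1 fun _ => post_val_of_lt⟩

theorem Knows.post (h : C.Knows t a) : (C.post k w cs).Knows t a := ⟨h.1.post, h.2⟩

theorem post_has {i : ℕ} (hi : i < k) :
    (C.post k w cs).Has (Term.var (C.next + i)) (w i) :=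
  ⟨by simpa [Term.vars, Config.post] using hi, post_val_add⟩

end Config

/-- The ground execution of `gs` leads from `C` to `C'`. -/
structure Run (P : Program) (gs : List Goal) (C C' : Config) : Prop where
  steps : ∀ G, Relation.ReflTransGen (Step P Mode.ground)
    ⟨gs ++ G, C.store, C.next⟩ ⟨G, C'.store, C'.next⟩
  valid : C'.Valid
  next_le : C.next ≤ C'.next
  agree : ∀ x < C.next, C'.val x = C.val x
  sub : ∃ μ, C'.store.sub = C.store.sub.comp μ

namespace Run

variable {P : Program} {gs gs' : List Goal} {C C' C'' : Config} {t u a : Term}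

theorem append (h : Run P gs C C') (h' : Run P gs' C' C'') : Run P (gs ++ gs') C C'' where
  steps G := by
    rw [List.append_assoc]
    exact (h.steps _).trans (h'.steps G)
  valid := h'.valid
  next_le := h.next_le.trans h'.next_le
  agree x hx := (h'.agree x (hx.trans_le h.next_le)).trans (h.agree x hx)
  sub := by
    obtain ⟨μ, hμ⟩ := h.sub
    obtain ⟨μ', hμ'⟩ := h'.sub
    exact ⟨μ.comp μ', by rw [hμ', hμ, Subst.comp_assoc]⟩

theorem has (h : Run P gs C C') (ht : C.Has t a) : C'.Has t a :=
  ⟨fun x hx => (ht.1 x hx).trans_le h.next_le, by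
    rw [← ht.2]; exact Config.subst_congr_of_agree ht.1 h.agree⟩

/-- Identifications made by the store are permanent. This carries knowledge gained later over to
terms unified earlier, such as the output arguments of a call. -/
theorem same (h : Run P gs C C') (htu : t.subst C.store.sub = u.subst C.store.sub) :
    t.subst C'.store.sub = u.subst C'.store.sub := by
  obtain ⟨μ, hμ⟩ := h.sub
  rw [hμ, ← Term.subst_subst, ← Term.subst_subst, htu]

theorem knows (h : Run P gs C C') (ht : C.Knows t a) : C'.Knows t a := by
  refine ⟨h.has ht.1, ?_⟩
  obtain ⟨μ, hμ⟩ := h.sub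
  rw [hμ, ← Term.subst_subst, ht.2.subst]
  exact ht.2

theorem nil (hC : C.Valid) : Run P [] C C where
  steps _ := .refl
  valid := hC
  next_le := le_rfl
  agree _ _ := rfl
  sub := ⟨Subst.id, (Subst.comp_id _).symm⟩

theorem reduce {g : Goal} {k : ℕ} {w : Subst} {cs : List Constraint} (hC : C.Valid)
    (hw : w.IsGround) (hr : Reduct P Mode.ground C.store.sub C.next g gs cs k)
    (hcs : ∀ δ : Subst, (∀ x < C.next, δ x = C.val x) → ∀ c ∈ cs, c.Holds δ)
    (h : Run P gs (C.post k w cs) C') : Run P [g] C C' where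
  steps G := .head (.reduce g G gs cs C.store C.next k hr
    ⟨_, (hC.post (k := k) hw hcs).ground,
      (hC.post (k := k) hw hcs).cons _ fun _ _ => rfl⟩) (h.steps G)
  valid := h.valid
  next_le := (Nat.le_add_right _ _).trans h.next_le
  agree x hx := (h.agree x (hx.trans_le (Nat.le_add_right _ _))).trans
    (Config.post_val_of_lt hx)
  sub := h.sub

end Run

/-- The ground execution of `gs` from `C` succeeds with a configuration satisfying `Q`. -/
def Leads (P : Program) (gs : List Goal) (C : Config) (Q : Config → Prop) : Prop :=
  ∃ C', Run P gs C C' ∧ Q C'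

namespace Leads

variable {P : Program} {g : Goal} {gs gs' : List Goal} {C : Config} {Q R : Config → Prop}
variable {t u a : Term}

theorem nil (hC : C.Valid) (hQ : Q C) : Leads P [] C Q := ⟨C, .nil hC, hQ⟩

theorem append (h : Leads P gs C Q) (h' : ∀ C', Run P gs C C' → Q C' → Leads P gs' C' R) :
    Leads P (gs ++ gs') C R := by
  obtain ⟨C', hr, hq⟩ := h
  obtain ⟨C'', hr', hq'⟩ := h' C' hr hq
  exact ⟨C'', hr.append hr', hq'⟩

theorem seq (h : Leads P [g] C Q) (h' : ∀ C', Run P [g] C C' → Q C' → Leads P gs C' R) :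
    Leads P (g :: gs) C R := h.append h'

theorem last (h : Leads P gs C Q) (h' : ∀ C', Run P gs C C' → Q C' → R C') :
    Leads P gs C R := by
  obtain ⟨C', hr, hq⟩ := h
  exact ⟨C', hr, h' C' hr hq⟩

theorem reduce' {k : ℕ} {cs : List Constraint} (w : Subst) (hC : C.Valid) (hw : w.IsGround)
    (hr : Reduct P Mode.ground C.store.sub C.next g gs cs k)
    (hcs : ∀ δ : Subst, (∀ x < C.next, δ x = C.val x) → ∀ c ∈ cs, c.Holds δ)
    (h : (C.post k w cs).Valid → Leads P gs (C.post k w cs) Q) : Leads P [g] C Q := by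
  obtain ⟨C', hr', hq⟩ := h (hC.post hw hcs)
  exact ⟨C', .reduce hC hw hr hcs hr', hq⟩

theorem reduce {k : ℕ} (w : Subst) (hC : C.Valid) (hw : w.IsGround)
    (hr : Reduct P Mode.ground C.store.sub C.next g gs [] k)
    (h : (C.post k w []).Valid → Leads P gs (C.post k w []) Q) : Leads P [g] C Q :=
  reduce' w hC hw hr (by simp) h

/-- The valuation unifies both instances, so a most general unifier exists and is absorbed by the
valuation; predicted values and constraints survive. Neither side need be known, hence the
conclusion only records that the store identifies them. -/
theorem eq (hC : C.Valid) (ht : C.Has t a) (hu : C.Has u a) :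
    Leads P [Goal.eq t u] C fun C' => t.subst C'.store.sub = u.subst C'.store.sub := by
  have hv : ∀ {s b : Term}, C.Has s b → ∀ x ∈ (s.subst C.store.sub).vars, x < C.next := by
    intro s b hs x hx
    obtain ⟨y, hy, hx⟩ := Term.mem_vars_subst.1 hx
    exact hC.range y (hs.1 y hy) x hx
  obtain ⟨μ, hμ, hout, hin⟩ := exists_isMGU (t := t.subst C.store.sub)
    (u := u.subst C.store.sub) (ν := C.val)
    (by rw [Term.subst_subst, Term.subst_subst, hC.fix, ht.2, hu.2]) (hv ht) (hv hu)
  have hval : μ.comp C.val = C.val := funext <| hμ.2 _ <| by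
    rw [Term.subst_subst, Term.subst_subst, hC.fix, ht.2, hu.2]
  have hcons : ∀ δ : Subst, (∀ x < C.next, δ x = C.val x) →
      ∀ c ∈ C.store.cons.map (Constraint.subst μ), c.Holds δ := by
    intro δ hδ c hc
    obtain ⟨d, hd, rfl⟩ := List.mem_map.1 hc
    rw [Constraint.holds_subst]
    refine hC.cons _ (fun x hx => ?_) d hd
    rw [← congrFun hval x]
    exact Config.subst_congr_of_agree (hin x hx) hδ
  refine ⟨⟨⟨C.store.sub.comp μ, C.store.cons.map (Constraint.subst μ)⟩, C.next, C.val⟩,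
    ⟨fun G => .single (.unify t u G C.store C.next μ hμ
      ⟨C.val, hC.ground, hcons _ fun _ _ => rfl⟩),
      ⟨hC.ground, ?_, fun x hx => ?_, fun x hx y hy => ?_, hcons⟩, le_rfl, fun _ _ => rfl,
      ⟨μ, rfl⟩⟩, ?_⟩
  · rw [Subst.comp_assoc, hval, hC.fix]
  · show (C.store.sub x).subst μ = _
    rw [hC.dom x hx]
    exact hout x hx
  · obtain ⟨z, hz, hy⟩ := Term.mem_vars_subst.1 hy
    exact hin z (hC.range x hx z hz) y hy
  · simpa only [Term.subst_subst] using hμ.1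

theorem eq_left (hC : C.Valid) (ht : C.Has t a) (hu : C.Knows u a) :
    Leads P [Goal.eq t u] C fun C' => C'.Knows t a :=
  (eq hC ht hu.1).last fun _ hr h => .of_eq (hr.has ht) (hr.knows hu) h

theorem eq_right (hC : C.Valid) (ht : C.Knows t a) (hu : C.Has u a) :
    Leads P [Goal.eq t u] C fun C' => C'.Knows u a :=
  (eq hC ht.1 hu).last fun _ hr h => .of_eq (hr.has hu) (hr.knows ht) h.symm

end Leads

/-! ### Ground execution of the heap operations -/

/-- The values `l` for the first few fresh variables. -/
def witness (l : List Term) : Subst := fun i => l.getD i Term.null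

theorem witness_isGround {l : List Term} (h : ∀ t ∈ l, t.Ground) : (witness l).IsGround := by
  intro i
  simp only [witness, List.getD_eq_getElem?_getD]
  cases hi : l[i]? with
  | none => rfl
  | some t => exact h t (List.mem_of_getElem? hi)

theorem MemCell.ref_mem {h r c : Term} (hm : MemCell h r c) : r ∈ h.locs := by
  induction hm with
  | head r c t => simp [Term.locs]
  | tail d t r c _ ih => unfold Term.locs; split <;> simp_all

theorem Term.locs_cons_loc (r c t : Term) :
    (Term.cons (Term.loc r c) t).locs = r :: t.locs := by simp [Term.locs]

theorem Term.nodup_locs_tail {d t : Term} (h : (Term.cons d t).locs.Nodup) : t.locs.Nodup := by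
  unfold Term.locs at h; split at h <;> simp_all

theorem ReplaceCell.ref_mem {h r c h' : Term} (hm : ReplaceCell h r c h') : r ∈ h.locs := by
  induction hm with
  | head r c c' t => simp [Term.locs]
  | tail d t r c t' _ ih => unfold Term.locs; split <;> simp_all

/-- Updates change only the content of a cell, so references stay distinct through set_field and
set_array. -/
theorem ReplaceCell.locs_eq {h r c h' : Term} (hm : ReplaceCell h r c h') : h'.locs = h.locs := by
  induction hm with
  | head r c c' t => simp [Term.locs]
  | tail d t r c t' _ ih =>
    by_cases hd : ∃ r u, d = Term.loc r u
    · obtain ⟨r, u, rfl⟩ := hd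
      rw [Term.locs_cons_loc, Term.locs_cons_loc, ih]
    · have hd' : ∀ r u, d ≠ Term.loc r u := fun r u h => hd ⟨r, u, h⟩
      rwa [Term.locs.eq_2 _ _ hd', Term.locs.eq_2 _ _ hd']

theorem MemCell.ground {h r c : Term} (hm : MemCell h r c) (hh : h.Ground) : c.Ground := by
  induction hm <;> simp_all

theorem ReplaceCell.ground {h r c h' : Term} (hm : ReplaceCell h r c h') (hh : h.Ground)
    (hc : c.Ground) : h'.Ground := by
  induction hm <;> simp_all

theorem FirstField.ground {F : FieldName} {v fs : Term} (h : FirstField F v fs)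
    (hfs : fs.Ground) : v.Ground := by
  induction h <;> simp_all

theorem ReplaceField.ground {F : FieldName} {v fs fs' : Term} (h : ReplaceField F v fs fs')
    (hfs : fs.Ground) (hv : v.Ground) : fs'.Ground := by
  induction h <;> simp_all

namespace Leads

open Config

variable {P : Program} {C : Config}

/-- The ground clauses stop at the first cell with the reference, while `MemCell` may point to a
later one. If references are distinct, no cell before the one sought carries its reference, and the
search reaches it. -/
theorem getCell {a b d : Term} (hm : MemCell a b d) : ∀ {C : Config} {h r c : Term}, C.Valid →
    a.locs.Nodup → C.Knows h a → C.Knows r b → C.Has c d →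
    Leads P [Goal.getCell h r c] C fun C' => C'.Knows c d := by
  induction hm with
  | head b d t =>
    intro C h r c hC _ hh hr hc
    refine reduce (witness []) hC (witness_isGround (by simp))
      (.getCell_found h r c b d t (hh.subst_eq hC) (hr.subst_eq hC)) fun hD => ?_
    have ha := hh.ground hC
    simp only [Term.ground_fun2] at ha
    exact eq_left hD hc.post (knows_of_ground ha.1.2)
  | tail e t b d hm ih =>
    intro C h r c hC hn hh hr hc
    have ha := hh.ground hC
    simp only [Term.ground_fun2] at ha
    refine reduce (witness []) hC (witness_isGround (by simp))
      (.getCell_next h r c e t (hh.subst_eq hC) ?_) fun hD => ?_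
    · rintro c' rfl
      rw [hr.subst_eq hC, Term.locs_cons_loc, List.nodup_cons] at hn
      exact hn.1 hm.ref_mem
    · exact ih hD (Term.nodup_locs_tail hn) (knows_of_ground ha.2) hr.post hc.post

theorem setCell {a b d e : Term} (hm : ReplaceCell a b d e) :
    ∀ {C : Config} {h r c h' : Term}, C.Valid →
    a.locs.Nodup → C.Knows h a → C.Knows r b → C.Knows c d → C.Has h' e →
    Leads P [Goal.setCell h r c h'] C fun C' => C'.Knows h' e := by
  induction hm with
  | head b d d' t =>
    intro C h r c h' hC _ hh hr hc hh'
    refine reduce (witness []) hC (witness_isGround (by simp))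
      (.setCell_found h r c h' b d' t (hh.subst_eq hC) (hr.subst_eq hC)) fun hD => ?_
    have ha := hh.ground hC
    simp only [Term.ground_fun2] at ha
    exact eq_left hD hh'.post ((hr.post.fun2 hc.post).fun2 (knows_of_ground ha.2))
  | tail f t b d t' hm ih =>
    intro C h r c h' hC hn hh hr hc hh'
    have ha := hh.ground hC
    simp only [Term.ground_fun2] at ha
    have ht' := hm.ground ha.2 (hc.ground hC)
    refine reduce (k := 1) (witness [t']) hC (witness_isGround (by simp [ht']))
      (.setCell_next h r c h' f t (hh.subst_eq hC) ?_) fun hD => ?_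
    · rintro c' rfl
      rw [hr.subst_eq hC, Term.locs_cons_loc, List.nodup_cons] at hn
      exact hn.1 hm.ref_mem
    have hv : (C.post 1 (witness [t']) []).Has (Term.var C.next) t' :=
      post_has (i := 0) (by simp)
    have hu := (has_of_ground (C := C.post 1 (witness [t']) []) ha.1).fun2 (f := Fun2.cons) hv
    -- The output heap is bound to a list whose tail is still open. This identification makes it
    -- known once the recursive call has determined the tail.
    refine (eq hD hh'.post hu).seq fun C1 r1 h1 => ?_
    refine (ih r1.valid (Term.nodup_locs_tail hn) (knows_of_ground ha.2) (r1.knows hr.post)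
      (r1.knows hc.post) (r1.has hv)).last fun C2 r2 h2 => ?_
    exact .of_eq (r2.has (r1.has hh'.post)) ((knows_of_ground ha.1).fun2 h2) (r2.same h1)

/-- Field names are constants, so whether an entry matches does not depend on instantiation.
`FirstField` can follow the first match exactly, and no distinctness is needed. -/
theorem memberDet {F : FieldName} {b f : Term} (hm : FirstField F b f) :
    ∀ {C : Config} {v fs : Term}, C.Valid → C.Knows fs f → C.Has v b →
    Leads P [Goal.memberDet F v fs] C fun C' => C'.Knows v b := by
  induction hm with
  | head t =>
    intro C v fs hC hfs hv
    have ha := hfs.ground hC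
    simp only [Term.ground_fun2] at ha
    exact reduce (witness []) hC (witness_isGround (by simp))
      (.memberDet_found F v fs b t (hfs.subst_eq hC)) fun hD =>
      eq_left hD hv.post (knows_of_ground ha.1.2)
  | tail F' d t hF hm ih =>
    intro C v fs hC hfs hv
    have ha := hfs.ground hC
    simp only [Term.ground_fun2] at ha
    exact reduce (witness []) hC (witness_isGround (by simp))
      (.memberDet_next F F' v fs d t (hfs.subst_eq hC) hF) fun hD =>
      ih hD (knows_of_ground ha.2) hv.post

theorem replaceDet {F : FieldName} {b f f' : Term} (hm : ReplaceField F b f f') :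
    ∀ {C : Config} {v fs fs' : Term}, C.Valid → C.Knows fs f → C.Knows v b → C.Has fs' f' →
    Leads P [Goal.replaceDet fs F v fs'] C fun C' => C'.Knows fs' f' := by
  induction hm with
  | head d t =>
    intro C v fs fs' hC hfs hv hfs'
    have ha := hfs.ground hC
    simp only [Term.ground_fun2] at ha
    exact reduce (witness []) hC (witness_isGround (by simp))
      (.replaceDet_found F v fs fs' d t (hfs.subst_eq hC)) fun hD =>
      eq_left hD hfs'.post (((knows_of_ground (Term.ground_const _)).fun2 hv.post).fun2 (knows_of_ground ha.2))
  | tail F' d t t' hF hm ih =>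
    intro C v fs fs' hC hfs hv hfs'
    have ha := hfs.ground hC
    simp only [Term.ground_fun2] at ha
    have ht' := hm.ground ha.2 (hv.ground hC)
    have hd : (Term.field F' d).Ground := by simp [ha.1.2]
    refine reduce (k := 1) (witness [t']) hC (witness_isGround (by simp [ht']))
      (.replaceDet_next F F' v fs fs' d t (hfs.subst_eq hC) hF) fun hD => ?_
    have hx : (C.post 1 (witness [t']) []).Has (Term.var C.next) t' :=
      post_has (i := 0) (by simp)
    have hu := (has_of_ground (C := C.post 1 (witness [t']) []) hd).fun2 (f := Fun2.cons) hx
    refine (eq hD hfs'.post hu).seq fun C1 r1 h1 => ?_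
    refine (ih r1.valid (knows_of_ground ha.2) (r1.knows hv.post) (r1.has hx)).last
      fun C2 r2 h2 => ?_
    exact .of_eq (r2.has (r1.has hfs'.post)) ((knows_of_ground hd).fun2 h2) (r2.same h1)

theorem has_listTail {C : Config} {u b : Term} {ts as : List Term} (hu : C.Has u b)
    (h : List.Forall₂ C.Has ts as) : C.Has (Term.listTail u ts) (Term.listTail b as) := by
  induction h with
  | nil => exact hu
  | cons h _ ih => exact h.fun2 ih

theorem post_has_freshVars {ys zs : List Term} {k : ℕ} (hk : ys.length ≤ k) :
    List.Forall₂ (C.post k (witness (ys ++ zs)) []).Has (freshVars C.next ys.length) ys := by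
  rw [List.forall₂_iff_get]
  refine ⟨by simp [freshVars], fun i h1 h2 => ?_⟩
  have := post_has (C := C) (k := k) (w := witness (ys ++ zs)) (cs := []) (i := i)
    (h2.trans_le hk)
  simpa [freshVars, witness, List.getElem?_append_left h2, List.getElem?_eq_getElem h2] using this

theorem vars_subset_listTail (u : Term) (ts : List Term) :
    u.vars ⊆ (Term.listTail u ts).vars := by
  induction ts with
  | nil => exact subset_rfl
  | cons t ts ih => exact ih.trans Finset.subset_union_right

theorem witness_append (ys zs : List Term) (i : ℕ) :
    witness (ys ++ zs) (ys.length + i) = witness zs i := by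
  simp [witness, List.getElem?_append_right]

theorem nth0 {a b d : Term} (hm : HasElem a b d) {i xs v : Term} (hC : C.Valid)
    (hi : C.Knows i a) (hxs : C.Knows xs b) (hv : C.Has v d) :
    Leads P [Goal.nth0 i xs v] C fun C' => C'.Knows v d := by
  obtain ⟨ys, rest, rfl, rfl⟩ := hm
  have hb := hxs.ground hC
  rw [Term.ground_listTail, Term.ground_fun2] at hb
  -- The index to guess is the length of the prefix `ys`; the fresh variables receive that prefix
  -- and then the tail behind the element.
  refine reduce (witness (ys ++ [rest])) hC (witness_isGround ?_) (.nth0 i xs v ys.length)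
    fun hD => ?_
  · simpa [or_imp, forall_and] using ⟨hb.2, hb.1.2⟩
  have hrest := post_has (C := C) (k := ys.length + 1) (w := witness (ys ++ [rest])) (cs := [])
    (i := ys.length) (by simp)
  rw [← Nat.add_zero ys.length, witness_append] at hrest
  have hl := has_listTail (hv.post.fun2 (f := Fun2.cons) hrest)
    (post_has_freshVars (C := C) (ys := ys) (zs := [rest]) (Nat.le_succ _))
  refine (eq_right hD hi.post (has_of_ground rfl)).seq fun C1 r1 _ => ?_
  refine (eq_right r1.valid (r1.knows hxs.post) (r1.has hl)).last fun C2 r2 h2 => ?_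
  exact h2.mono (r2.has (r1.has hv.post))
    fun x hx => vars_subset_listTail _ _ (Finset.mem_union_left _ hx)

theorem replaceNth0 {a b d b' : Term} (hm : ReplaceElem b a d b') {i xs v xs' : Term}
    (hC : C.Valid) (hi : C.Knows i a) (hxs : C.Knows xs b) (hv : C.Knows v d)
    (hxs' : C.Has xs' b') :
    Leads P [Goal.replaceNth0 xs i v xs'] C fun C' => C'.Knows xs' b' := by
  obtain ⟨ys, d₀, rest, rfl, rfl, rfl⟩ := hm
  have hb := hxs.ground hC
  rw [Term.ground_listTail, Term.ground_fun2] at hb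
  refine reduce (witness (ys ++ [d₀, rest])) hC (witness_isGround ?_)
    (.replaceNth0 xs i v xs' ys.length) fun hD => ?_
  · simp only [List.mem_append, List.mem_cons, List.not_mem_nil, or_false]
    rintro t (ht | rfl | rfl)
    exacts [hb.2 t ht, hb.1.1, hb.1.2]
  have hd := post_has (C := C) (k := ys.length + 2) (w := witness (ys ++ [d₀, rest])) (cs := [])
    (i := ys.length + 0) (by simp)
  have hrest := post_has (C := C) (k := ys.length + 2) (w := witness (ys ++ [d₀, rest]))
    (cs := []) (i := ys.length + 1) (by simp)
  rw [witness_append] at hd hrest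
  have hys := post_has_freshVars (C := C) (ys := ys) (zs := [d₀, rest]) (k := ys.length + 2)
    (by simp)
  have hl := has_listTail (hd.fun2 (f := Fun2.cons) hrest) hys
  have hl' := has_listTail (hv.1.post.fun2 (f := Fun2.cons) hrest) hys
  refine (eq_right hD hi.post (has_of_ground rfl)).seq fun C1 r1 _ => ?_
  refine (eq_right r1.valid (r1.knows hxs.post) (r1.has hl)).seq fun C2 r2 h2 => ?_
  refine eq_left r2.valid (r2.has (r1.has hxs'.post)) ⟨r2.has (r1.has hl'), ?_⟩
  have h3 := h2.2
  -- Both list patterns share the prefix and the tail. Matching with the known list has made these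
  -- ground, and the new element is known.
  rw [Term.subst_listTail, Term.ground_listTail] at h3 ⊢
  exact ⟨Term.ground_fun2.2 ⟨(r2.knows (r1.knows hv.post)).2, (Term.ground_fun2.1 h3.1).2⟩, h3.2⟩

end Leads

/-! ### Ground execution of guards and instructions -/

namespace Config.Knows

variable {C : Config} {f : Fun2} {t u s a b : Term}

theorem fun2_left (h : C.Knows (.fun2 f t u) a) (ht : C.Has t b) : C.Knows t b :=
  h.mono ht Finset.subset_union_left

theorem fun2_right (h : C.Knows (.fun2 f t u) a) (hu : C.Has u b) : C.Knows u b :=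
  h.mono hu Finset.subset_union_right

theorem array3_fst (h : C.Knows (.array3 t u s) a) (ht : C.Has t b) : C.Knows t b :=
  ⟨ht, (Term.ground_array3.1 h.2).1⟩

theorem array3_snd (h : C.Knows (.array3 t u s) a) (hu : C.Has u b) : C.Knows u b :=
  ⟨hu, (Term.ground_array3.1 h.2).2.1⟩

theorem array3_trd (h : C.Knows (.array3 t u s) a) (hs : C.Has s b) : C.Knows s b :=
  ⟨hs, (Term.ground_array3.1 h.2).2.2⟩

end Config.Knows

namespace Leads

open Config

variable {P : Program} {C : Config}

theorem buildObject {a b : Term} (hm : IsDefaultObject P a b) {c ob : Term} (hC : C.Valid)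
    (hc : C.Knows c a) (hob : C.Has ob b) :
    Leads P [Goal.buildObject c ob] C fun C' => C'.Knows ob b := by
  obtain ⟨D, fs, hfs, rfl, rfl⟩ := hm
  refine reduce (witness []) hC (witness_isGround (by simp)) (.buildObject c ob D fs hfs)
    fun hD => ?_
  refine (eq_right hD hc.post (has_of_ground (Term.ground_const _))).seq fun C1 r1 _ => ?_
  exact eq_left r1.valid (r1.has hob.post)
    ((knows_of_ground (Term.ground_const _)).fun2 (knows_of_ground (initFields_ground fs)))

theorem buildArray {T : Ty} {a b : Term} (hm : IsDefaultArray T a b) {l ar : Term}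
    (hC : C.Valid) (hl : C.Knows l a) (har : C.Has ar b) :
    Leads P [Goal.buildArray T l ar] C fun C' => C'.Knows ar b := by
  obtain ⟨k, rfl, rfl⟩ := hm
  refine reduce (witness []) hC (witness_isGround (by simp)) (.buildArray T l ar k)
    fun hD => ?_
  refine (eq_right hD hl.post (has_of_ground (Term.ground_num _))).seq fun C1 r1 _ => ?_
  exact eq_left r1.valid (r1.has har.post)
    ((knows_of_ground T.toTerm_ground).array3 (r1.knows hl.post)
      (knows_of_ground (T.defaults_ground k)))

theorem newRef {a b : Term} (hm : IsNewRef a b) {h r : Term} (hC : C.Valid)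
    (hh : C.Has h a) (hr : C.Has r b) :
    Leads P [Goal.newRef h r] C fun C' => C'.Knows r b := by
  obtain ⟨k, rfl, hk⟩ := hm
  -- Any number may be tried; the one taken is the reference that the derivation predicts, which is
  -- absent from the predicted heap.
  refine reduce' (witness []) hC (witness_isGround (by simp)) (.newRef h r k)
    (fun δ hδ c hc => ?_) fun hD => ?_
  · obtain rfl := List.mem_singleton.1 hc
    simp only [Constraint.Holds, Term.subst, subst_congr_of_agree hh.1 hδ, hh.2]
    exact hk
  · exact eq_left hD hr.post (knows_of_ground (Term.ground_num _))

theorem subclass {a t : Term} {D : ClassName} (hm : IsSubclassTerm P a D) (hC : C.Valid)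
    (ht : C.Has t a) : Leads P [Goal.subclass t D] C fun C' => C'.Knows t a := by
  obtain ⟨E, hE, rfl⟩ := hm
  exact reduce (witness []) hC (witness_isGround (by simp)) (.subclass t D E hE) fun hD =>
    eq_left hD ht.post (knows_of_ground (Term.ground_const _))

theorem rel {op : ROp} {a b t u : Term} (hm : (Goal.rel op a b).IsTrue P) (hC : C.Valid)
    (ht : C.Has t a) (hu : C.Has u b) : Leads P [Goal.rel op t u] C fun _ => True := by
  refine reduce' (witness []) hC (witness_isGround (by simp)) (.rel op t u)
    (fun δ hδ c hc => ?_) fun hD => .nil hD trivial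
  obtain rfl := List.mem_singleton.1 hc
  simp only [Constraint.Holds, subst_congr_of_agree ht.1 hδ, subst_congr_of_agree hu.1 hδ,
    ht.2, hu.2]
  exact hm

theorem neq {a b t u : Term} (hm : a ≠ b) (hC : C.Valid)
    (ht : C.Has t a) (hu : C.Has u b) : Leads P [Goal.neq t u] C fun _ => True := by
  refine reduce' (witness []) hC (witness_isGround (by simp)) (.neq t u)
    (fun δ hδ c hc => ?_) fun hD => .nil hD trivial
  obtain rfl := List.mem_singleton.1 hc
  simp only [Constraint.Holds, subst_congr_of_agree ht.1 hδ, subst_congr_of_agree hu.1 hδ,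
    ht.2, hu.2]
  exact hm

/-- Known operands make the computing rule applicable, so the result becomes known instead of being
merely constrained. -/
theorem arith {op : AOp} {a b c x t u : Term} (hm : (Goal.arith op c a b).IsTrue P)
    (hC : C.Valid) (hx : C.Has x c) (ht : C.Knows t a) (hu : C.Knows u b) :
    Leads P [Goal.arith op x t u] C fun C' => C'.Knows x c := by
  obtain ⟨i, j, k, rfl, rfl, rfl, hk⟩ := hm
  exact reduce (witness []) hC (witness_isGround (by simp))
    (.arith_eval op x t u i j k (ht.subst_eq hC) (hu.subst_eq hC) hk) fun hD =>
    eq_left hD hx.post (knows_of_ground (Term.ground_num _))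

theorem type {a b d h r t : Term} (hm : (Goal.type a b d).IsTrue P) (hC : C.Valid)
    (hn : a.locs.Nodup) (hh : C.Knows h a) (hr : C.Knows r b) (ht : C.Has t d) :
    Leads P [Goal.type h r t] C fun C' => C'.Knows t d := by
  obtain ⟨fs, hm⟩ := hm
  have hg := hm.ground (hh.ground hC)
  have hfs := (Term.ground_fun2.1 hg).2
  -- The values follow the order in which the rule introduces its variables: the cell, then its
  -- unknown parts.
  refine reduce (witness [Term.object d fs, fs]) hC
    (witness_isGround (by simpa using Term.ground_fun2.1 hg)) (.type h r t) fun hD => ?_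
  set D := C.post 2 (witness [Term.object d fs, fs]) []
  have h0 : D.Has (Term.var C.next) (Term.object d fs) := post_has (i := 0) (by simp)
  have h1 : D.Has (Term.var (C.next + 1)) fs := post_has (i := 1) (by simp)
  refine (getCell hm hD hn hh.post hr.post h0).seq fun C1 r1 k1 => ?_
  refine (eq_right r1.valid k1 (r1.has (ht.post.fun2 h1))).last fun C2 r2 k2 => ?_
  exact k2.fun2_left (r2.has (r1.has ht.post))

theorem length {a b d h r l : Term} (hm : (Goal.length a b d).IsTrue P) (hC : C.Valid)
    (hn : a.locs.Nodup) (hh : C.Knows h a) (hr : C.Knows r b) (hl : C.Has l d) :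
    Leads P [Goal.length h r l] C fun C' => C'.Knows l d := by
  obtain ⟨T, xs, hm⟩ := hm
  have hg := hm.ground (hh.ground hC)
  have hg' := Term.ground_array3.1 hg
  refine reduce (witness [Term.array3 T d xs, T, xs]) hC
    (witness_isGround (by simpa using ⟨hg', hg'.1, hg'.2.2⟩)) (.length h r l) fun hD => ?_
  set D := C.post 3 (witness [Term.array3 T d xs, T, xs]) []
  have h0 : D.Has (Term.var C.next) (Term.array3 T d xs) := post_has (i := 0) (by simp)
  have h1 : D.Has (Term.var (C.next + 1)) T := post_has (i := 1) (by simp)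
  have h2 : D.Has (Term.var (C.next + 2)) xs := post_has (i := 2) (by simp)
  refine (getCell hm hD hn hh.post hr.post h0).seq fun C1 r1 k1 => ?_
  refine (eq_right r1.valid k1 (r1.has (h1.array3 hl.post h2))).last fun C2 r2 k2 => ?_
  exact k2.array3_snd (r2.has (r1.has hl.post))

theorem newObject {a c b e h t r h' : Term} (hm : (Goal.newObject a c b e).IsTrue P)
    (hC : C.Valid) (hh : C.Knows h a) (ht : C.Knows t c) (hr : C.Has r b) (hh' : C.Has h' e) :
    Leads P [Goal.newObject h t r h'] C fun C' => C'.Knows r b ∧ C'.Knows h' e := by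
  obtain ⟨ob, hob, hnew, rfl⟩ := hm
  have hg := hh'.ground hC
  simp only [Term.ground_fun2] at hg
  refine reduce (witness [ob]) hC (witness_isGround (by simpa using hg.1.2))
    (.newObject h t r h') fun hD => ?_
  set D := C.post 1 (witness [ob]) []
  have h0 : D.Has (Term.var C.next) ob := post_has (i := 0) (by simp)
  refine (buildObject hob hD ht.post h0).seq fun C1 r1 k1 => ?_
  refine (newRef hnew r1.valid (r1.knows hh.post).1 (r1.has hr.post)).seq fun C2 r2 k2 => ?_
  refine (eq_left r2.valid (r2.has (r1.has hh'.post))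
    ((k2.fun2 (r2.knows k1)).fun2 (r2.knows (r1.knows hh.post)))).last fun C3 r3 k3 => ?_
  exact ⟨r3.knows k2, k3⟩

theorem newArray {T : Ty} {a c b e h l r h' : Term} (hm : (Goal.newArray a T c b e).IsTrue P)
    (hC : C.Valid) (hh : C.Knows h a) (hl : C.Knows l c) (hr : C.Has r b) (hh' : C.Has h' e) :
    Leads P [Goal.newArray h T l r h'] C fun C' => C'.Knows r b ∧ C'.Knows h' e := by
  obtain ⟨ar, har, hnew, rfl⟩ := hm
  have hg := hh'.ground hC
  simp only [Term.ground_fun2] at hg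
  refine reduce (witness [ar]) hC (witness_isGround (by simpa using hg.1.2))
    (.newArray h T l r h') fun hD => ?_
  set D := C.post 1 (witness [ar]) []
  have h0 : D.Has (Term.var C.next) ar := post_has (i := 0) (by simp)
  refine (buildArray har hD hl.post h0).seq fun C1 r1 k1 => ?_
  refine (newRef hnew r1.valid (r1.knows hh.post).1 (r1.has hr.post)).seq fun C2 r2 k2 => ?_
  refine (eq_left r2.valid (r2.has (r1.has hh'.post))
    ((k2.fun2 (r2.knows k1)).fun2 (r2.knows (r1.knows hh.post)))).last fun C3 r3 k3 => ?_
  exact ⟨r3.knows k2, k3⟩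

theorem getField {E : ClassName} {F : FieldName} {a b d h r v : Term}
    (hm : (Goal.getField a b E F d).IsTrue P) (hC : C.Valid) (hn : a.locs.Nodup)
    (hh : C.Knows h a) (hr : C.Knows r b) (hv : C.Has v d) :
    Leads P [Goal.getField h r E F v] C fun C' => C'.Knows v d := by
  obtain ⟨T, fs, hm, hT, hf⟩ := hm
  have hg := hm.ground (hh.ground hC)
  refine reduce (witness [Term.object T fs, T, fs]) hC
    (witness_isGround (by simpa using Term.ground_fun2.1 hg)) (.getField h r E F v) fun hD => ?_
  set D := C.post 3 (witness [Term.object T fs, T, fs]) []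
  have h0 : D.Has (Term.var C.next) (Term.object T fs) := post_has (i := 0) (by simp)
  have h1 : D.Has (Term.var (C.next + 1)) T := post_has (i := 1) (by simp)
  have h2 : D.Has (Term.var (C.next + 2)) fs := post_has (i := 2) (by simp)
  refine (getCell hm hD hn hh.post hr.post h0).seq fun C1 r1 k1 => ?_
  refine (eq_right r1.valid k1 (r1.has (h1.fun2 h2))).seq fun C2 r2 k2 => ?_
  refine (subclass hT r2.valid (r2.has (r1.has h1))).seq fun C3 r3 _ => ?_
  exact memberDet hf r3.valid (r3.knows (k2.fun2_right (r2.has (r1.has h2))))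
    (r3.has (r2.has (r1.has hv.post)))

theorem setField {E : ClassName} {F : FieldName} {a b d e h r v h' : Term}
    (hm : (Goal.setField a b E F d e).IsTrue P) (hC : C.Valid) (hn : a.locs.Nodup)
    (hh : C.Knows h a) (hr : C.Knows r b) (hv : C.Knows v d) (hh' : C.Has h' e) :
    Leads P [Goal.setField h r E F v h'] C fun C' => C'.Knows h' e := by
  obtain ⟨T, fs, fs', hm, hT, hf, hs⟩ := hm
  have hg := Term.ground_fun2.1 (hm.ground (hh.ground hC))
  have hg' := hf.ground hg.2 (hv.ground hC)
  refine reduce (witness [Term.object T fs, T, fs, fs']) hC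
    (witness_isGround (by simpa using ⟨hg, hg.1, hg.2, hg'⟩)) (.setField h r E F v h')
    fun hD => ?_
  set D := C.post 4 (witness [Term.object T fs, T, fs, fs']) []
  have h0 : D.Has (Term.var C.next) (Term.object T fs) := post_has (i := 0) (by simp)
  have h1 : D.Has (Term.var (C.next + 1)) T := post_has (i := 1) (by simp)
  have h2 : D.Has (Term.var (C.next + 2)) fs := post_has (i := 2) (by simp)
  have h3 : D.Has (Term.var (C.next + 3)) fs' := post_has (i := 3) (by simp)
  refine (getCell hm hD hn hh.post hr.post h0).seq fun C1 r1 k1 => ?_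
  refine (eq_right r1.valid k1 (r1.has (h1.fun2 h2))).seq fun C2 r2 k2 => ?_
  refine (subclass hT r2.valid (r2.has (r1.has h1))).seq fun C3 r3 k3 => ?_
  refine (replaceDet hf r3.valid (r3.knows (k2.fun2_right (r2.has (r1.has h2))))
    (r3.knows (r2.knows (r1.knows hv.post))) (r3.has (r2.has (r1.has h3)))).seq
    fun C4 r4 k4 => ?_
  have r := ((r1.append r2).append r3).append r4
  exact setCell hs r4.valid hn (r.knows hh.post) (r.knows hr.post) ((r4.knows k3).fun2 k4)
    (r.has hh'.post)

theorem getArray {a b i d h r t v : Term} (hm : (Goal.getArray a b i d).IsTrue P)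
    (hC : C.Valid) (hn : a.locs.Nodup) (hh : C.Knows h a) (hr : C.Knows r b)
    (ht : C.Knows t i) (hv : C.Has v d) :
    Leads P [Goal.getArray h r t v] C fun C' => C'.Knows v d := by
  obtain ⟨T, l, xs, hm, hx⟩ := hm
  have hg := Term.ground_array3.1 (hm.ground (hh.ground hC))
  refine reduce (witness [Term.array3 T l xs, T, l, xs]) hC
    (witness_isGround (by simp [hg.1, hg.2.1, hg.2.2])) (.getArray h r t v) fun hD => ?_
  set D := C.post 4 (witness [Term.array3 T l xs, T, l, xs]) []
  have h0 : D.Has (Term.var C.next) (Term.array3 T l xs) := post_has (i := 0) (by simp)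
  have h1 : D.Has (Term.var (C.next + 1)) T := post_has (i := 1) (by simp)
  have h2 : D.Has (Term.var (C.next + 2)) l := post_has (i := 2) (by simp)
  have h3 : D.Has (Term.var (C.next + 3)) xs := post_has (i := 3) (by simp)
  refine (getCell hm hD hn hh.post hr.post h0).seq fun C1 r1 k1 => ?_
  refine (eq_right r1.valid k1 (r1.has (h1.array3 h2 h3))).seq fun C2 r2 k2 => ?_
  exact nth0 hx r2.valid (r2.knows (r1.knows ht.post)) (k2.array3_trd (r2.has (r1.has h3)))
    (r2.has (r1.has hv.post))

theorem _root_.CLP.ReplaceElem.ground {xs i v xs' : Term} (h : ReplaceElem xs i v xs')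
    (hxs : xs.Ground) (hv : v.Ground) : xs'.Ground := by
  obtain ⟨ys, d, rest, rfl, rfl, rfl⟩ := h
  rw [Term.ground_listTail, Term.ground_fun2] at hxs ⊢
  exact ⟨⟨hv, hxs.1.2⟩, hxs.2⟩

theorem setArray {a b i d e h r t v h' : Term} (hm : (Goal.setArray a b i d e).IsTrue P)
    (hC : C.Valid) (hn : a.locs.Nodup) (hh : C.Knows h a) (hr : C.Knows r b)
    (ht : C.Knows t i) (hv : C.Knows v d) (hh' : C.Has h' e) :
    Leads P [Goal.setArray h r t v h'] C fun C' => C'.Knows h' e := by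
  obtain ⟨T, l, xs, xs', hm, hx, hs⟩ := hm
  have hg := Term.ground_array3.1 (hm.ground (hh.ground hC))
  have hg' := hx.ground hg.2.2 (hv.ground hC)
  refine reduce (witness [Term.array3 T l xs, T, l, xs, xs']) hC
    (witness_isGround (by simpa using ⟨hg, hg.1, hg.2.1, hg.2.2, hg'⟩)) (.setArray h r t v h')
    fun hD => ?_
  set D := C.post 5 (witness [Term.array3 T l xs, T, l, xs, xs']) []
  have h0 : D.Has (Term.var C.next) (Term.array3 T l xs) := post_has (i := 0) (by simp)
  have h1 : D.Has (Term.var (C.next + 1)) T := post_has (i := 1) (by simp)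
  have h2 : D.Has (Term.var (C.next + 2)) l := post_has (i := 2) (by simp)
  have h3 : D.Has (Term.var (C.next + 3)) xs := post_has (i := 3) (by simp)
  have h4 : D.Has (Term.var (C.next + 4)) xs' := post_has (i := 4) (by simp)
  refine (getCell hm hD hn hh.post hr.post h0).seq fun C1 r1 k1 => ?_
  refine (eq_right r1.valid k1 (r1.has (h1.array3 h2 h3))).seq fun C2 r2 k2 => ?_
  refine (replaceNth0 hx r2.valid (r2.knows (r1.knows ht.post))
    (k2.array3_trd (r2.has (r1.has h3))) (r2.knows (r1.knows hv.post))
    (r2.has (r1.has h4))).seq fun C3 r3 k3 => ?_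
  have r := (r1.append r2).append r3
  have k2 := r3.knows k2
  exact setCell hs r3.valid hn (r.knows hh.post) (r.knows hr.post)
    ((k2.array3_fst (r.has h1)).array3 (k2.array3_snd (r.has h2)) k3) (r.has hh'.post)

end Leads

/-! ### Ground execution of clauses -/

/-- `C` has the values `τ` for the first `K` variables, renamed by `ren`. -/
def Config.Env (C : Config) (ren τ : Subst) (K : ℕ) : Prop := ∀ x < K, C.Has (ren x) (τ x)

/-- `C` determines the values of the variables in `D`. -/
def Config.KnowsAll (C : Config) (ren τ : Subst) (D : Finset ℕ) : Prop :=
  ∀ x ∈ D, C.Knows (ren x) (τ x)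

namespace Config

variable {C : Config} {ren τ : Subst} {K : ℕ} {t : Term}

theorem has_subst (h : ∀ x ∈ t.vars, C.Has (ren x) (τ x)) :
    C.Has (t.subst ren) (t.subst τ) := by
  refine ⟨fun x hx => ?_, ?_⟩
  · obtain ⟨y, hy, hx⟩ := Term.mem_vars_subst.1 hx
    exact (h y hy).1 x hx
  · rw [Term.subst_subst]
    exact Term.subst_congr fun x hx => (h x hx).2

theorem Env.has (h : C.Env ren τ K) (ht : ∀ x ∈ t.vars, x < K) :
    C.Has (t.subst ren) (t.subst τ) := has_subst fun x hx => h x (ht x hx)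

theorem KnowsAll.knows {D : Finset ℕ} (h : C.KnowsAll ren τ D) (ht : t.vars ⊆ D) :
    C.Knows (t.subst ren) (t.subst τ) :=
  ⟨has_subst fun x hx => (h x (ht hx)).1, by
    rw [Term.subst_subst]
    exact Term.ground_subst_iff.2 fun x hx => (h x (ht hx)).2⟩

/-- A ground instance leaves no variable of the pattern open: matching a pattern with a known term
makes all its variables known. -/
theorem Knows.knowsAll {a : Term} (h : C.Knows (t.subst ren) a)
    (hx : ∀ x ∈ t.vars, C.Has (ren x) (τ x)) : C.KnowsAll ren τ t.vars := fun x hxt =>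
  h.mono (hx x hxt) fun _ hy => Term.mem_vars_subst.2 ⟨x, hxt, hy⟩

theorem KnowsAll.mono {D D' : Finset ℕ} (h : C.KnowsAll ren τ D) (hD : D' ⊆ D) :
    C.KnowsAll ren τ D' := fun x hx => h x (hD hx)

theorem KnowsAll.union {D D' : Finset ℕ} (h : C.KnowsAll ren τ D) (h' : C.KnowsAll ren τ D') :
    C.KnowsAll ren τ (D ∪ D') := fun x hx => (Finset.mem_union.1 hx).elim (h x) (h' x)

theorem KnowsAll.singleton {x : ℕ} (h : C.Knows (ren x) (τ x)) : C.KnowsAll ren τ {x} :=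
  fun y hy => by rwa [Finset.mem_singleton.1 hy]

theorem KnowsAll.empty : C.KnowsAll ren τ ∅ := by simp [KnowsAll]

end Config

namespace Run

variable {P : Program} {gs : List Goal} {C C' : Config} {ren τ : Subst}

theorem env {K : ℕ} (h : Run P gs C C') (hE : C.Env ren τ K) : C'.Env ren τ K :=
  fun x hx => h.has (hE x hx)

theorem knowsAll {D : Finset ℕ} (h : Run P gs C C') (hD : C.KnowsAll ren τ D) :
    C'.KnowsAll ren τ D := fun x hx => h.knows (hD x hx)

end Run

/-- The ground execution of a derivable call succeeds when its inputs are known. -/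
def Goal.CallSucceeds (P : Program) : Goal → Prop
  | call p a o h h' e => h.locs.Nodup → ∀ (C : Config) (ta tout th th' te : Term), C.Valid →
      C.Knows ta a → C.Knows th h → C.Has tout o → C.Has th' h' → C.Has te e →
      Leads P [call p ta tout th th' te] C fun C' =>
        -- Distinctness is also returned for the output heap, as the remaining instructions of the
        -- caller rely on it.
        C'.Knows tout o ∧ C'.Knows th' h' ∧ C'.Knows te e ∧ h'.locs.Nodup
  | _ => True

theorem IsNewRef.nodup_locs {h r h' c : Term} (hr : IsNewRef h r) (hn : h.locs.Nodup)
    (hh' : h' = Term.cons (Term.loc r c) h) : h'.locs.Nodup := by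
  obtain ⟨k, rfl, hk⟩ := hr
  rw [hh', Term.locs_cons_loc]
  exact List.nodup_cons.2 ⟨hk, hn⟩

namespace Leads

open Config

variable {P : Program} {C : Config} {ren τ : Subst} {K : ℕ}

theorem guard {g : Guard} {h : ℕ} (hC : C.Valid) (hE : C.Env ren τ K)
    (hK : ∀ x ∈ g.inputs ∪ g.outputs, x < K) (hh : C.Knows (ren h) (τ h))
    (hn : (τ h).locs.Nodup) (hin : C.KnowsAll ren τ g.inputs)
    (hg : ((g.goal h).subst τ).IsTrue P) :
    Leads P [(g.goal h).subst ren] C fun C' => C'.KnowsAll ren τ g.outputs := by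
  cases g with
  | rel op t u =>
    exact (rel hg hC (hin.knows Finset.subset_union_left).1
      (hin.knows Finset.subset_union_right).1).last fun _ _ _ => .empty
  | neq t u =>
    exact (neq hg hC (hin.knows Finset.subset_union_left).1
      (hin.knows Finset.subset_union_right).1).last fun _ _ _ => .empty
  | type r t =>
    have ht : ∀ x ∈ t.vars, x < K := fun x hx => hK x (Finset.mem_union_right _ hx)
    exact (type hg hC hn hh (hin.knows subset_rfl) (hE.has ht)).last fun _ r k =>
      k.knowsAll fun x hx => r.has (hE x (ht x hx))

theorem guards {h : ℕ} (hn : (τ h).locs.Nodup) (gs : List Guard) :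
    ∀ {C : Config} {D : Finset ℕ}, C.Valid → C.Env ren τ K →
    (∀ g ∈ gs, ∀ x ∈ g.inputs ∪ g.outputs, x < K) → C.Knows (ren h) (τ h) →
    C.KnowsAll ren τ D → Clause.GuardsOk D gs →
    (∀ g ∈ gs, ((g.goal h).subst τ).IsTrue P) →
    Leads P ((gs.map (Guard.goal h)).map (Goal.subst ren)) C fun C' =>
      C'.KnowsAll ren τ (gs.foldl (fun D g => D ∪ g.outputs) D) := by
  induction gs with
  | nil => exact fun hC _ _ _ hD _ _ => .nil hC hD
  | cons g gs ih =>
    intro C D hC hE hK hh hD hok hg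
    rw [List.forall_mem_cons] at hK hg
    refine (guard hC hE hK.1 hh hn (hD.mono hok.1) hg.1).seq fun C' r k => ?_
    exact ih r.valid (r.env hE) hK.2 (r.knows hh) ((r.knowsAll hD).union k) hok.2 hg.2

/-- The invariant passed along a body: the outputs and the resulting heap become known, and
references stay distinct. For a call this is supplied by `hcall`, which comes from the induction on
derivations. -/
theorem instr {i : Instr} {h : ℕ} (hC : C.Valid) (hE : C.Env ren τ K)
    (hK : ∀ x ∈ i.inputs ∪ i.outputs, x < K) (hhK : i.outHeap h < K)
    (hh : C.Knows (ren h) (τ h)) (hn : (τ h).locs.Nodup) (hin : C.KnowsAll ren τ i.inputs)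
    (hg : Derivable P ((i.goal h (i.outHeap h)).subst τ))
    (hcall : ((i.goal h (i.outHeap h)).subst τ).CallSucceeds P) :
    Leads P [(i.goal h (i.outHeap h)).subst ren] C fun C' => C'.KnowsAll ren τ i.outputs ∧
      C'.Knows (ren (i.outHeap h)) (τ (i.outHeap h)) ∧ (τ (i.outHeap h)).locs.Nodup := by
  have hout : ∀ x ∈ i.outputs, x < K := fun x hx => hK x (Finset.mem_union_right _ hx)
  have hheap := hE _ hhK
  cases i with
  | arith op x t u =>
    exact (arith (hg.true rfl) hC (hE x (hout x (by simp [Instr.outputs])))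
      (hin.knows Finset.subset_union_left) (hin.knows Finset.subset_union_right)).last
      fun _ r k => ⟨.singleton k, r.knows hh, hn⟩
  | call p argsIn argsOut e =>
    have ho : ∀ x ∈ (Term.list argsOut).vars, x < K := fun x hx =>
      hout x (Finset.mem_union_left _ hx)
    have he : ∀ x ∈ e.vars, x < K := fun x hx => hout x (Finset.mem_union_right _ hx)
    refine (hcall hn C _ _ _ _ _ hC (hin.knows subset_rfl) hh (hE.has ho) hheap
      (hE.has he)).last fun C' r k => ⟨.union ?_ ?_, k.2.1, k.2.2.2⟩
    · exact k.1.knowsAll fun x hx => r.has (hE x (ho x hx))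
    · exact k.2.2.1.knowsAll fun x hx => r.has (hE x (he x hx))
  | newObject c x =>
    have hg := hg.true rfl
    refine (newObject hg hC hh (hin.knows subset_rfl)
      (hE x (hout x (by simp [Instr.outputs]))) hheap).last
      fun _ r k => ⟨.singleton k.1, k.2, ?_⟩
    obtain ⟨ob, -, hnew, heq⟩ := hg
    exact hnew.nodup_locs hn heq
  | newArray T l x =>
    have hg := hg.true rfl
    refine (newArray hg hC hh (hin.knows subset_rfl)
      (hE x (hout x (by simp [Instr.outputs]))) hheap).last
      fun _ r k => ⟨.singleton k.1, k.2, ?_⟩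
    obtain ⟨ob, -, hnew, heq⟩ := hg
    exact hnew.nodup_locs hn heq
  | length r x =>
    exact (length (hg.true rfl) hC hn hh (hin.knows subset_rfl)
      (hE x (hout x (by simp [Instr.outputs])))).last
      fun _ r k => ⟨.singleton k, r.knows hh, hn⟩
  | getField r E F x =>
    exact (getField (hg.true rfl) hC hn hh (hin.knows subset_rfl)
      (hE x (hout x (by simp [Instr.outputs])))).last
      fun _ r k => ⟨.singleton k, r.knows hh, hn⟩
  | setField r E F d =>
    have hg := hg.true rfl
    refine (setField hg hC hn hh (hin.knows Finset.subset_union_left)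
      (hin.knows Finset.subset_union_right) hheap).last fun _ r k => ⟨.empty, k, ?_⟩
    obtain ⟨T, fs, fs', -, -, -, hs⟩ := hg
    exact hs.locs_eq ▸ hn
  | getArray r t x =>
    exact (getArray (hg.true rfl) hC hn hh (hin.knows Finset.subset_union_left)
      (hin.knows Finset.subset_union_right) (hE x (hout x (by simp [Instr.outputs])))).last
      fun _ r k => ⟨.singleton k, r.knows hh, hn⟩
  | setArray r t d =>
    have hg := hg.true rfl
    refine (setArray hg hC hn hh
      (hin.knows (Finset.subset_union_left.trans Finset.subset_union_left))
      (hin.knows (Finset.subset_union_right.trans Finset.subset_union_left))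
      (hin.knows Finset.subset_union_right) hheap).last fun _ r k => ⟨.empty, k, ?_⟩
    obtain ⟨T, l, xs, xs', -, -, hs⟩ := hg
    exact hs.locs_eq ▸ hn

theorem _root_.CLP.Instr.le_outHeap (h : ℕ) (i : Instr) : h ≤ i.outHeap h := by
  cases i <;> simp [Instr.outHeap]

theorem _root_.CLP.le_lastHeap (is : List Instr) : ∀ h, h ≤ lastHeap h is := by
  induction is with
  | nil => exact fun h => le_rfl
  | cons i is ih => exact fun h => (i.le_outHeap h).trans (ih _)

theorem body {out : Finset ℕ} (is : List Instr) : ∀ {C : Config} {D : Finset ℕ} {h : ℕ},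
    C.Valid → C.Env ren τ K → (∀ i ∈ is, ∀ x ∈ i.inputs ∪ i.outputs, x < K) →
    lastHeap h is < K → C.Knows (ren h) (τ h) → (τ h).locs.Nodup → C.KnowsAll ren τ D →
    Clause.BodyOk out D is →
    (∀ g ∈ bodyGoals h is, Derivable P (g.subst τ) ∧ (g.subst τ).CallSucceeds P) →
    Leads P ((bodyGoals h is).map (Goal.subst ren)) C fun C' => C'.KnowsAll ren τ out ∧
      C'.Knows (ren (lastHeap h is)) (τ (lastHeap h is)) ∧ (τ (lastHeap h is)).locs.Nodup := by
  induction is with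
  | nil => exact fun hC _ _ _ hh hn hD hok _ => .nil hC ⟨hD.mono hok, hh, hn⟩
  | cons i is ih =>
    intro C D h hC hE hK hlast hh hn hD hok hg
    rw [bodyGoals, List.forall_mem_cons] at hg
    rw [List.forall_mem_cons] at hK
    refine (instr hC hE hK.1 ((le_lastHeap is _).trans_lt hlast) hh hn (hD.mono hok.1)
      hg.1.1 hg.1.2).seq fun C' r k => ?_
    exact ih r.valid (r.env hE) hK.2 hlast k.2.1 k.2.2 ((r.knowsAll hD).union k.1) hok.2 hg.2

end Leads

/-! ### Completeness of ground execution for derivable calls -/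

theorem lt_varBound {s : Finset ℕ} {x : ℕ} (h : x ∈ s) : x < varBound s :=
  Finset.le_sup (f := (· + 1)) h

theorem mem_foldr_union {α : Type*} (f g : α → Finset ℕ) (l : List α) (x : ℕ) :
    x ∈ l.foldr (fun a D => f a ∪ g a ∪ D) ∅ ↔ ∃ a ∈ l, x ∈ f a ∪ g a := by
  induction l with
  | nil => simp
  | cons a l ih => simp only [List.foldr_cons, Finset.mem_union, ih, List.exists_mem_cons_iff]

/-- The derivation names the clause to resolve with and the values `τ` of its variables. The head
equations make the inputs known and tie the output arguments to those of the clause; definedness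
before use makes the latter known at the end of the body, and the ties pass this on to the caller.
-/
theorem Derivable.callSucceeds {P : Program} {g : Goal} (hg : Derivable P g) :
    g.CallSucceeds P := by
  induction hg with
  | prim g hg => cases g <;> first | exact False.elim hg | trivial
  | call c τ hc hτ hrhs ih =>
    intro hn C ta tout th th' te hC ha hh ho hh' he
    refine Leads.reduce τ hC hτ (.call c ta tout th th' te hc) fun hD => ?_
    set D := C.post (c.heapOut + 1) τ []
    set ren : Subst := fun x => Term.var (C.next + x)
    have hE : D.Env ren τ (c.heapOut + 1) := fun x hx => Config.post_has hx
    -- Heap variables are numbered above all others of the clause, the output heap last, so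
    -- `c.heapOut + 1` bounds every variable that is renamed.
    have hlt : ∀ x ∈ c.vars, x < c.heapOut + 1 := fun x hx =>
      ((lt_varBound hx).trans_le (le_lastHeap c.body _)).trans (Nat.lt_succ_self _)
    have hvin : ∀ x ∈ (Term.list c.argsIn).vars, x < c.heapOut + 1 := fun x hx =>
      hlt x (by simp only [Clause.vars, listVars, Finset.mem_union]; tauto)
    have hvout : ∀ x ∈ (Term.list c.argsOut).vars, x < c.heapOut + 1 := fun x hx =>
      hlt x (by simp only [Clause.vars, listVars, Finset.mem_union]; tauto)
    have hvex : ∀ x ∈ c.exFlag.vars, x < c.heapOut + 1 := fun x hx =>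
      hlt x (by simp only [Clause.vars, listVars, Finset.mem_union]; tauto)
    have hvg : ∀ g ∈ c.guards, ∀ x ∈ g.inputs ∪ g.outputs, x < c.heapOut + 1 :=
      fun g hg x hx => hlt x <| by
        rw [Clause.vars]
        exact Finset.mem_union_left _ (Finset.mem_union_right _
          ((mem_foldr_union _ _ _ _).2 ⟨g, hg, hx⟩))
    have hvb : ∀ i ∈ c.body, ∀ x ∈ i.inputs ∪ i.outputs, x < c.heapOut + 1 :=
      fun i hi x hx => hlt x <| by
        rw [Clause.vars]
        exact Finset.mem_union_right _ ((mem_foldr_union _ _ _ _).2 ⟨i, hi, hx⟩)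
    have hok := P.defined c hc
    refine (show Leads P (c.headEqs ren ta tout th th' te) D fun C' =>
        C'.KnowsAll ren τ (listVars c.argsIn) ∧ C'.Knows (ren c.heapIn) (τ c.heapIn) ∧
        tout.subst C'.store.sub = ((Term.list c.argsOut).subst ren).subst C'.store.sub ∧
        th'.subst C'.store.sub = (ren c.heapOut).subst C'.store.sub ∧
        te.subst C'.store.sub = (c.exFlag.subst ren).subst C'.store.sub from ?_).append ?_
    · refine (Leads.eq_right hD ha.post (hE.has hvin)).seq fun C1 r1 k1 => ?_
      refine (Leads.eq r1.valid (r1.has ho.post) (r1.has (hE.has hvout))).seq fun C2 r2 k2 => ?_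
      have r := r1.append r2
      refine (Leads.eq_right r2.valid (r.knows hh.post) (r.has (hE c.heapIn
        ((le_lastHeap c.body _).trans_lt (Nat.lt_succ_self _))))).seq fun C3 r3 k3 => ?_
      have r := r.append r3
      refine (Leads.eq r3.valid (r.has hh'.post)
        (r.has (hE c.heapOut (Nat.lt_succ_self _)))).seq fun C4 r4 k4 => ?_
      have r := r.append r4
      refine (Leads.eq r4.valid (r.has he.post) (r.has (hE.has hvex))).last fun C5 r5 k5 => ?_
      have r := r.append r5
      refine ⟨?_, r5.knows (r4.knows k3), r5.same (r4.same (r3.same k2)), r5.same k4, k5⟩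
      exact (((r2.append r3).append (r4.append r5)).knows k1).knowsAll fun x hx =>
        r.has (hE x (hvin x hx))
    · rintro C1 r1 ⟨k1, k2, k3, k4, k5⟩
      simp only [Clause.rhs, List.forall_mem_append, List.map_append,
        List.forall_mem_map] at hrhs ih ⊢
      refine (Leads.guards hn c.guards r1.valid (r1.env hE) hvg k2 k1 hok.1
        fun g hg => (hrhs.1 g hg).true (by cases g <;> rfl)).append fun C2 r2 l => ?_
      refine (Leads.body c.body r2.valid (r2.env (r1.env hE)) hvb (Nat.lt_succ_self _)
        (r2.knows k2) hn l hok.2 fun g hg => ⟨hrhs.2 g hg, ih.2 g hg⟩).last fun C3 r3 m => ?_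
      have r := (r1.append r2).append r3
      exact ⟨.of_eq (r.has ho.post) (m.1.knows Finset.subset_union_left)
          (r3.same (r2.same k3)),
        .of_eq (r.has hh'.post) m.2.1 (r3.same (r2.same k4)),
        .of_eq (r.has he.post) (m.1.knows Finset.subset_union_right) (r3.same (r2.same k5)),
        m.2.2⟩

end CLP

/-! ### The correctness theorem -/

theorem mainTheorem1 (P : CLP.Program) (m : CLP.PredName) (θ : CLP.Store)
    (hθ : CLP.SymbolicBranch P m θ)
    (σ' : CLP.Subst) (hσ' : CLP.IsInstantiation σ' θ)
    (hargs : (σ' CLP.argsIn).Ground)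
    (hheap : (σ' CLP.heapIn).Ground)
    (hdistinct : (σ' CLP.heapIn).locs.Nodup) :
    ∃ θ' : CLP.Store, CLP.GroundExecution P m σ' θ' ∧ (θ'.after σ').Le θ := by
  open CLP in
  obtain ⟨ρ, hρ, v, hv⟩ := hσ'
  obtain ⟨n, hθ⟩ := hθ
  -- The single solution of the symbolic constraints that fixes all predicted values.
  have hw : IsSolution (ρ.comp v) θ.cons :=
    ⟨.comp _ hv.1, fun c hc => Constraint.holds_subst.1 (hv.2 _ (List.mem_map_of_mem hc))⟩
  have hd := (derivable_of_derivation hθ hw (Subst.comp_id _)).2 _ List.mem_cons_self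
  have hval : ∀ x ∈ queryVars, (θ.sub x).subst (ρ.comp v) = (σ' x).subst v := fun x hx => by
    rw [hρ x hx, Term.subst_subst]
  -- The output arguments of the query may still contain variables; `v` predicts their values.
  let C : Config := ⟨⟨Subst.id, []⟩,
    varBound (queryVars.biUnion fun x => (σ' x).vars), v⟩
  have hC : C.Valid :=
    ⟨hv.1, rfl, fun _ _ => rfl, fun x hx y hy => by
      obtain rfl : y = x := by simpa [C, Subst.id, Term.vars] using hy
      exact hx, by simp [C]⟩
  have has : ∀ x ∈ queryVars, C.Has (σ' x) ((σ' x).subst v) := fun x hx =>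
    ⟨fun y hy => lt_varBound (Finset.mem_biUnion.2 ⟨x, hx, hy⟩), rfl⟩
  have qi : ∀ x, x = argsIn ∨ x = argsOut ∨ x = heapIn ∨ x = heapOut ∨ x = exFlag →
      x ∈ queryVars := by simp [queryVars]
  have hcall : Derivable P (.call m ((σ' argsIn).subst v) ((σ' argsOut).subst v)
      ((σ' heapIn).subst v) ((σ' heapOut).subst v) ((σ' exFlag).subst v)) := by
    rw [← hval _ (qi _ (by simp)), ← hval _ (qi _ (by simp)), ← hval _ (qi _ (by simp)),
      ← hval _ (qi _ (by simp)), ← hval _ (qi _ (by simp))]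
    exact hd
  have known : ∀ x ∈ queryVars, (σ' x).Ground → C.Knows (σ' x) ((σ' x).subst v) :=
    fun x hx hg => ⟨has x hx, by rwa [hg.subst]⟩
  obtain ⟨C', r, ko, kh, ke, -⟩ := hcall.callSucceeds
    (by rwa [hheap.subst]) C _ _ _ _ _ hC (known argsIn (qi _ (by simp)) hargs)
    (known heapIn (qi _ (by simp)) hheap) (has argsOut (qi _ (by simp)))
    (has heapOut (qi _ (by simp))) (has exFlag (qi _ (by simp)))
  have all : ∀ x ∈ queryVars, C'.Knows (σ' x) ((σ' x).subst v) := by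
    intro x hx
    simp only [queryVars, Finset.mem_insert, Finset.mem_singleton] at hx
    rcases hx with rfl | rfl | rfl | rfl | rfl
    exacts [r.knows (known argsIn (qi _ (by simp)) hargs), ko,
      r.knows (known heapIn (qi _ (by simp)) hheap), kh, ke]
  -- The solution `ρ.comp v` serves for every `u`, because the query terms are already ground in the
  -- final store.
  refine ⟨C'.store, ⟨C'.next, r.steps []⟩, ⟨ρ.comp C'.store.sub, fun x hx => ?_⟩,
    fun u _ => ⟨ρ.comp v, hw, fun x hx => ?_⟩⟩
  · show (σ' x).subst C'.store.sub = _
    rw [hρ x hx, Term.subst_subst]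
  · show ((σ' x).subst C'.store.sub).subst u = _
    rw [(all x hx).2.subst, (all x hx).subst_eq r.valid, hval x hx]
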